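/- **Setting.** Let $\mathcal L_r$ be a relational extension of $\mathcal L_{\mathrm{field}}\cup\Omega$, where $\mathcal L_{\mathrm{field}}=\{0,1,+,\cdot,-,{}^{-1}\}$ (with $0^{-1}=0$) and $\Omega$ is a set of constants. Let $\mathcal L$ be a possibly many-sorted extension of $\mathcal L_r$ with a distinguished field sort, such that the restriction of $\mathcal L$ to the field sort is $\mathcal L_r$; in particular the only function symbols with values in the field sort are those of $\mathcal L_{\mathrm{field}}\cup\Omega$. The other sorts are called auxiliary. A formula is *field sort quantifier-free* if it has no quantifiers over the field sort (quantifiers over auxiliary sorts are allowed). A theory *eliminates field sort quantifiers* if every formula, with free variables of arbitrary sorts, is equivalent modulo the theory to a field sort quantifier-free formula in the same free variables. Let $T=\mathrm{Th}(K_0)$, where $K_0$ is an $\mathcal L$-structure whose field sort is a field of characteristic $0$, and let $\chi(x,z)$ be an $\mathcal L$-formula, with $x$ a single field variable and $z$ a tuple of variables of any sorts, such that the sets $\chi(K_0,a)$ form a basis of neighbourhoods of $0$ for a non-discrete Hausdorff field topology on $K_0$. In every model of $T$ the field sort carries the field topology with basis of neighbourhoods of $0$ defined by $\chi$. Assume that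 $T$ is an *open theory of topological fields*, that is: 1. $T$ eliminates field sort quantifiers in $\mathcal L$; 2. for all tuples $x$ of field variables and $w$ of auxiliary variables, every field sort quantifier-free $\mathcal L$-formula $\varphi(x,w)$ is equivalent modulo $T$ to a finite disjunction $$\bigvee_{i\in I}\Big(\bigwedge_{j\in J_i}P_{ij}(x)=0\ \wedge\ \theta_i(x,w)\Big)$$ where $J_i$ is finite (possibly empty), $P_{ij}\in\mathbb Q(\Omega)[x]\setminus\{0\}$, and the $\theta_i$ are $\mathcal L$-formulas such that $\theta_i(K,c)$ is open for every model $K$ of $T$ and every tuple $c$ of elements of auxiliary sorts of $K$. Let $\mathcal L_\delta$ be $\mathcal L$ with an additional unary function symbol $\delta$ on the field sort. Let $T_\delta$ be $T$ together with the axioms stating that $\delta$ is a derivation of the field sort and that $\delta(c)=0$ for all $c\in\Omega$. Let $T_\delta^*$ be the $\mathcal L_\delta$-theory whose models are the models $K$ of $T_\delta$ which satisfy the following scheme (DL): for all $m\geq 1$, every differential polynomial $P\in K\{x\}$ in one differential variable of order $m$, every $z$ and every $y=(y_0,\dots,y_m)\in K^{m+1}$, $$P^*(y)=0\wedge s_P^*(y)\neq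 0\ \Longrightarrow\ \exists x\in K:\ P(x)=0\wedge s_P(x)\neq 0\wedge\bigwedge_{j=0}^{m}\chi(\delta^j(x)-y_j,z).$$ Here $P^*$ is the ordinary polynomial with $P(x)=P^*(x,\delta x,\dots,\delta^m x)$, $s_P=\partial P/\partial(\delta^m x)$ is the separant of $P$, and $s_P^*=\partial P^*/\partial y_m$. **Theorem.** Assume that $T$ is an open theory of topological fields and that $T_\delta^*$ is consistent. Then $T_\delta^*$ eliminates field sort quantifiers in $\mathcal L_\delta$. Consequently, $T_\delta^*$ is complete. -/

import Mathlib

universe u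

namespace GenericDerivation

/-- A many-sorted first-order language with a distinguished field sort. The symbols of the
language of fields (`0, 1, +, *, -` and inverse) are always present. The remaining symbols are a
set `Const` of constants of the field sort (the set called Ω), function symbols with values in an
auxiliary sort, and relation symbols. Function and relation symbols may take arguments of all
sorts: the `p` field arguments are listed first, then the `q` auxiliary arguments, of sorts `σ`.
The only function symbols with values in the field sort are those of the language of fields and
the constants, so the language induced on the field sort is a relational extension of the language
of fields together with Ω. -/
structure FieldLanguage where
  /-- the auxiliary sorts -/
  Aux : Type u
  /-- the additional constants of the field sort -/
  Const : Type u
  /-- the function symbols with values in the auxiliary sort `a` -/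
  Func : (p q : ℕ) → (σ : Fin q → Aux) → (a : Aux) → Type u
  /-- the relation symbols -/
  Rel : (p q : ℕ) → (σ : Fin q → Aux) → Type u

variable {L : FieldLanguage.{u}} {D : Type}

/-- Terms of the field sort in `n` field variables. Here `D` is a set of additional unary function
symbols on the field sort: `D = Empty` for the language `L` itself and `D = Unit` for its
extension by one symbol for a derivation. -/
inductive FieldTerm (L : FieldLanguage.{u}) (D : Type) (n : ℕ) : Type u
  | var (i : Fin n) : FieldTerm L D n
  | const (c : L.Const) : FieldTerm L D n
  | zero : FieldTerm L D n
  | one : FieldTerm L D n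
  | add (s t : FieldTerm L D n) : FieldTerm L D n
  | mul (s t : FieldTerm L D n) : FieldTerm L D n
  | neg (t : FieldTerm L D n) : FieldTerm L D n
  | inv (t : FieldTerm L D n) : FieldTerm L D n
  | op (d : D) (t : FieldTerm L D n) : FieldTerm L D n

/-- Terms of auxiliary sorts in `n` field variables and auxiliary variables of sorts `Δ`. -/
inductive AuxTerm (L : FieldLanguage.{u}) (D : Type) (n : ℕ) {l : ℕ} (Δ : Fin l → L.Aux) :
    L.Aux → Type u
  | var (j : Fin l) : AuxTerm L D n Δ (Δ j)
  | app {p q : ℕ} {σ : Fin q → L.Aux} {a : L.Aux} (f : L.Func p q σ a)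
      (s : Fin p → FieldTerm L D n) (t : ∀ j, AuxTerm L D n Δ (σ j)) : AuxTerm L D n Δ a

/-- First-order formulas whose free variables are `n` field variables and auxiliary variables of
sorts `Δ`. A quantifier binds the new variable number `0` of its sort. -/
inductive Formula (L : FieldLanguage.{u}) (D : Type) :
    (n : ℕ) → {l : ℕ} → (Δ : Fin l → L.Aux) → Type u
  | falsum {n l : ℕ} {Δ : Fin l → L.Aux} : Formula L D n Δ
  | eqField {n l : ℕ} {Δ : Fin l → L.Aux} (s t : FieldTerm L D n) : Formula L D n Δ
  | eqAux {n l : ℕ} {Δ : Fin l → L.Aux} {a : L.Aux} (s t : AuxTerm L D n Δ a) : Formula L D n Δ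
  | rel {n l : ℕ} {Δ : Fin l → L.Aux} {p q : ℕ} {σ : Fin q → L.Aux} (R : L.Rel p q σ)
      (s : Fin p → FieldTerm L D n) (t : ∀ j, AuxTerm L D n Δ (σ j)) : Formula L D n Δ
  | imp {n l : ℕ} {Δ : Fin l → L.Aux} (φ ψ : Formula L D n Δ) : Formula L D n Δ
  | allField {n l : ℕ} {Δ : Fin l → L.Aux} (φ : Formula L D (n + 1) Δ) : Formula L D n Δ
  | allAux {n l : ℕ} {Δ : Fin l → L.Aux} (a : L.Aux)
      (φ : Formula L D n (Fin.cons a Δ : Fin (l + 1) → L.Aux)) : Formula L D n Δ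

/-- A formula is field sort quantifier-free if it has no quantifier over the field sort; quantifiers
over auxiliary sorts are allowed. -/
def Formula.FieldQuantifierFree : {n l : ℕ} → {Δ : Fin l → L.Aux} → Formula L D n Δ → Prop
  | _, _, _, .falsum => True
  | _, _, _, .eqField _ _ => True
  | _, _, _, .eqAux _ _ => True
  | _, _, _, .rel _ _ _ => True
  | _, _, _, .imp φ ψ => φ.FieldQuantifierFree ∧ ψ.FieldQuantifierFree
  | _, _, _, .allField _ => False
  | _, _, _, .allAux _ φ => φ.FieldQuantifierFree

/-- A sentence is a formula without free variables. -/
abbrev Sentence (L : FieldLanguage.{u}) (D : Type) : Type u :=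
  Formula L D 0 (Fin.elim0 : Fin 0 → L.Aux)

/-- A structure whose field sort is a field, the symbols of the language of fields being
interpreted by the field operations, with the convention that the inverse of `0` is `0`. All
theories considered here contain the field axioms, so all their models are of this form. -/
structure Str (L : FieldLanguage.{u}) (D : Type) where
  /-- the field sort -/
  K : Type u
  [field : Field K]
  /-- the auxiliary sorts -/
  aux : L.Aux → Type u
  /-- the constants from Ω -/
  const : L.Const → K
  /-- the function symbols with values in auxiliary sorts -/
  func : {p q : ℕ} → {σ : Fin q → L.Aux} → {a : L.Aux} → L.Func p q σ a →
    (Fin p → K) → (∀ j, aux (σ j)) → aux a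
  /-- the relation symbols -/
  rel : {p q : ℕ} → {σ : Fin q → L.Aux} → L.Rel p q σ → (Fin p → K) → (∀ j, aux (σ j)) → Prop
  /-- the additional unary functions on the field sort -/
  op : D → K → K

attribute [instance] Str.field

/-- The value of a field term. -/
def FieldTerm.eval (M : Str L D) {n : ℕ} (x : Fin n → M.K) : FieldTerm L D n → M.K
  | .var i => x i
  | .const c => M.const c
  | .zero => 0
  | .one => 1
  | .add s t => s.eval M x + t.eval M x
  | .mul s t => s.eval M x * t.eval M x
  | .neg t => -t.eval M x
  | .inv t => (t.eval M x)⁻¹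
  | .op d t => M.op d (t.eval M x)

/-- The value of a term of an auxiliary sort. -/
def AuxTerm.eval (M : Str L D) {n l : ℕ} {Δ : Fin l → L.Aux} (x : Fin n → M.K)
    (w : ∀ j, M.aux (Δ j)) : {a : L.Aux} → AuxTerm L D n Δ a → M.aux a
  | _, .var j => w j
  | _, .app f s t => M.func f (fun i => (s i).eval M x) (fun j => (t j).eval M x w)

/-- Tarskian satisfaction of a formula by a tuple `x` of field elements and a tuple `w` of elements
of auxiliary sorts. -/
def Formula.Realize (M : Str L D) : {n l : ℕ} → {Δ : Fin l → L.Aux} → Formula L D n Δ →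
    (Fin n → M.K) → (∀ j, M.aux (Δ j)) → Prop
  | _, _, _, .falsum, _, _ => False
  | _, _, _, .eqField s t, x, _ => s.eval M x = t.eval M x
  | _, _, _, .eqAux s t, x, w => s.eval M x w = t.eval M x w
  | _, _, _, .rel R s t, x, w => M.rel R (fun i => (s i).eval M x) (fun j => (t j).eval M x w)
  | _, _, _, .imp φ ψ, x, w => φ.Realize M x w → ψ.Realize M x w
  | _, _, _, .allField φ, x, w => ∀ b : M.K, φ.Realize M (Fin.cons b x) w
  | _, l, Δ, .allAux a φ, x, w => ∀ b : M.aux a, φ.Realize M x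
      (Fin.cons (α := fun j => M.aux ((Fin.cons a Δ : Fin (l + 1) → L.Aux) j)) b w)

/-- The truth of a sentence in a structure. -/
def Str.Satisfies (M : Str L D) (φ : Sentence L D) : Prop :=
  φ.Realize M Fin.elim0 (fun j => j.elim0)

/-- A theory is a set of sentences. -/
abbrev Theory (L : FieldLanguage.{u}) (D : Type) : Type u := Set (Sentence L D)

/-- `M` is a model of `T`. -/
def Str.Models (M : Str L D) (T : Theory L D) : Prop := ∀ φ ∈ T, M.Satisfies φ

/-- The complete theory of a structure. -/
def Str.theory (M : Str L D) : Theory L D := {φ | M.Satisfies φ}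

/-- A theory is consistent if it has a model. -/
def Theory.Consistent (T : Theory L D) : Prop := ∃ M : Str L D, M.Models T

/-- A theory is complete if it is consistent and decides every sentence. -/
def Theory.Complete (T : Theory L D) : Prop :=
  T.Consistent ∧ ∀ φ : Sentence L D,
    (∀ M : Str L D, M.Models T → M.Satisfies φ) ∨ (∀ M : Str L D, M.Models T → ¬ M.Satisfies φ)

/-- A theory eliminates field sort quantifiers if every formula, with free variables of arbitrary
sorts, is equivalent modulo the theory to a field sort quantifier-free formula in the same
variables. -/
def Theory.EliminatesFieldQuantifiers (T : Theory L D) : Prop :=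
  ∀ (n l : ℕ) (Δ : Fin l → L.Aux) (φ : Formula L D n Δ),
    ∃ ψ : Formula L D n Δ, ψ.FieldQuantifierFree ∧
      ∀ M : Str L D, M.Models T → ∀ (x : Fin n → M.K) (w : ∀ j, M.aux (Δ j)),
        φ.Realize M x w ↔ ψ.Realize M x w

/-- The reduct to `L`, forgetting the additional unary functions. -/
def Str.reduct (M : Str L D) : Str L Empty where
  K := M.K
  aux := M.aux
  const := M.const
  func := M.func
  rel := M.rel
  op := fun d => d.elim

/-! ### Definable field topologies -/

/-- The subset of the field sort defined by a formula `χ(x, z)`, `x` being the first field variable,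
for the value `z` of the remaining variables, which may be of arbitrary sorts. -/
def basicSet (M : Str L Empty) {p l : ℕ} {Δ : Fin l → L.Aux} (χ : Formula L Empty (p + 1) Δ)
    (z : (Fin p → M.K) × (∀ j, M.aux (Δ j))) : Set M.K :=
  {x | χ.Realize M (Fin.cons x z.1) z.2}

/-- `χ` defines a non-discrete Hausdorff field topology on the field sort of `M`. -/
def DefinesFieldTopology (M : Str L Empty) {p l : ℕ} {Δ : Fin l → L.Aux}
    (χ : Formula L Empty (p + 1) Δ) : Prop :=
  ∃ _ : TopologicalSpace M.K, IsTopologicalDivisionRing M.K ∧ T2Space M.K ∧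
    ¬ DiscreteTopology M.K ∧
    (nhds (0 : M.K)).HasBasis (fun _ : (Fin p → M.K) × (∀ j, M.aux (Δ j)) => True) (basicSet M χ)

/-- `U` is open in the product topology on `K ^ n`, where `K` carries the topology for which the
sets defined by `χ` form a basis of neighbourhoods of `0`. -/
def IsOpenFor (M : Str L Empty) {p l : ℕ} {Δ : Fin l → L.Aux} (χ : Formula L Empty (p + 1) Δ)
    {n : ℕ} (U : Set (Fin n → M.K)) : Prop :=
  ∀ a ∈ U, ∃ z, ∀ y : Fin n → M.K, (∀ i, y i - a i ∈ basicSet M χ z) → y ∈ U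

/-! ### Open theories of topological fields -/

/-- The canonical homomorphism from `ℤ[Ω]` to the field sort of a structure. -/
noncomputable def Str.coeffHom (M : Str L Empty) : MvPolynomial L.Const ℤ →+* M.K :=
  MvPolynomial.eval₂Hom (Int.castRingHom M.K) M.const

/-- `T` is the complete theory of an `L`-structure whose field sort is a field of characteristic
`0` on which `χ` defines a field topology. -/
def IsTheoryOfTopologicalFields (T : Theory L Empty) {p l : ℕ} {Δ : Fin l → L.Aux}
    (χ : Formula L Empty (p + 1) Δ) : Prop :=
  ∃ K₀ : Str L Empty, CharZero K₀.K ∧ DefinesFieldTopology K₀ χ ∧ T = K₀.theory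

/-- The formula `φ(x, w)`, where `x` are field variables and `w` auxiliary variables, is equivalent
modulo `T` to a finite disjunction of formulas `P₁(x) = 0 ∧ … ∧ P_r(x) = 0 ∧ θ(x, w)`, where the
`P_j` are non-zero polynomials over `ℚ(Ω)` and `θ(x, w)` defines, for every value of `w` in every
model of `T`, an open set. Clearing denominators, the `P_j` are taken with coefficients in `ℤ[Ω]`;
being non-zero refers to the coefficients as elements of the models of `T`. -/
def HasOpenForm (T : Theory L Empty) {p l : ℕ} {Δ : Fin l → L.Aux}
    (χ : Formula L Empty (p + 1) Δ) {n k : ℕ} {E : Fin k → L.Aux} (φ : Formula L Empty n E) :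
    Prop :=
  ∃ S : List (List (MvPolynomial (Fin n) (MvPolynomial L.Const ℤ)) × Formula L Empty n E),
    (∀ d ∈ S, ∀ M : Str L Empty, M.Models T →
      (∀ P ∈ d.1, P.map M.coeffHom ≠ 0) ∧
      ∀ w : ∀ j, M.aux (E j), IsOpenFor M χ {x | d.2.Realize M x w}) ∧
    ∀ M : Str L Empty, M.Models T → ∀ (x : Fin n → M.K) (w : ∀ j, M.aux (E j)),
      φ.Realize M x w ↔
        ∃ d ∈ S, (∀ P ∈ d.1, P.eval₂ M.coeffHom x = 0) ∧ d.2.Realize M x w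

/-- Open theories of topological fields, the topology being given by `χ`. -/
structure IsOpenTheory (T : Theory L Empty) {p l : ℕ} {Δ : Fin l → L.Aux}
    (χ : Formula L Empty (p + 1) Δ) : Prop where
  topological : IsTheoryOfTopologicalFields T χ
  eliminates : T.EliminatesFieldQuantifiers
  openForm : ∀ (n k : ℕ) (E : Fin k → L.Aux) (φ : Formula L Empty n E),
    φ.FieldQuantifierFree → HasOpenForm T χ φ

/-! ### Generic derivations -/

/-- The derivation symbol of the language `L_δ`, interpreted in a structure. -/
def Str.der (M : Str L Unit) : M.K → M.K := M.op ()

/-- `M` is a model of `T_δ`: a model of `T` with a derivation on the field sort which vanishes on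
the constants from Ω. -/
def IsDifferentialModel (T : Theory L Empty) (M : Str L Unit) : Prop :=
  M.reduct.Models T ∧
  (∀ x y : M.K, M.der (x + y) = M.der x + M.der y) ∧
  (∀ x y : M.K, M.der (x * y) = M.der x * y + x * M.der y) ∧
  ∀ c : L.Const, M.der (M.const c) = 0

/-- The axiom scheme (DL). Differential polynomials in one differential indeterminate over `K` are
polynomials in the indeterminates `δ^j(x)`, `j ∈ ℕ`, that is, elements of `MvPolynomial ℕ K`. If
`P` has order `m`, then `P*(y)` is `eval y P`, which only depends on `y 0, …, y m`, the value
of `P` at `b ∈ K` is `eval (fun j => δ^j(b)) P`, and the separant is `pderiv m P`. -/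
def SatisfiesDL (M : Str L Unit) {p l : ℕ} {Δ : Fin l → L.Aux}
    (χ : Formula L Empty (p + 1) Δ) : Prop :=
  ∀ (m : ℕ) (P : MvPolynomial ℕ M.K), 1 ≤ m → m ∈ P.vars → (∀ j ∈ P.vars, j ≤ m) →
    ∀ (z : (Fin p → M.K) × (∀ j, M.aux (Δ j))) (y : ℕ → M.K),
      MvPolynomial.eval y P = 0 → MvPolynomial.eval y (MvPolynomial.pderiv m P) ≠ 0 →
      ∃ b : M.K,
        MvPolynomial.eval (fun j => M.der^[j] b) P = 0 ∧
        MvPolynomial.eval (fun j => M.der^[j] b) (MvPolynomial.pderiv m P) ≠ 0 ∧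
        ∀ j ≤ m, M.der^[j] b - y j ∈ basicSet M.reduct χ z

/-- The `L_δ`-theory `T_δ^*`, given as the set of all `L_δ`-sentences which hold in all models of
`T_δ` satisfying the axiom scheme (DL). -/
def genericTheory (T : Theory L Empty) {p l : ℕ} {Δ : Fin l → L.Aux}
    (χ : Formula L Empty (p + 1) Δ) : Theory L Unit :=
  {φ | ∀ M : Str L Unit, IsDifferentialModel T M → SatisfiesDL M χ → M.Satisfies φ}

end GenericDerivation

/-! ### Substitution of terms and universal closures. -/

namespace GenericDerivation

variable {L : FieldLanguage.{u}} {D : Type}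

/-! ### Substitution of field terms -/

/-! By induction on formulas, it suffices to eliminate one quantifier `∃ x` over the field sort in
front of a field sort quantifier-free formula of `L_δ`. The rules of differentiation push `δ` down
to the variables, so such a formula is an `L`-condition `Φ` on the jet `(x, δx, δ²x, …)` and on a
family `b` of parameters closed under `δ`. Since `T` eliminates field sort quantifiers, the goal is
just some `L`-condition on `b` equivalent to the existence of `x`; this is `Definable.eliminable`.

The open normal form splits `Φ` into polynomial equations and an open condition. If the equations
are trivial for the given `b`, then (DL) for the equation `δ^m x = 0` approximates any tuple by a
jet, so the open condition is satisfied by a jet as soon as it is satisfied by some tuple.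

Otherwise `x` satisfies a non-trivial equation, and one argues by induction on its order `m`
(`eliminatesOrderLT`) and on its degree in `δ^m x` (`eliminatesDegree`). Case distinctions on the
vanishing of coefficients and of the separant lower order or degree, or lead to `P = 0` with leading
coefficient and separant non-zero. There all derivatives are term functions of `x, …, δ^m x`
(`exists_termFun_iterate`), so `Φ` becomes a condition on a finite jet. The equations in its normal
form are reduced modulo `P` by pseudo-division (`eliminable_separant_ne_zero`). A remainder yields
an equation of lower order or degree unless it is trivial (`eliminable_of_natDegree_lt`). What is
left is `P = 0`, a non-zero separant and an open condition, which is the situation of (DL)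
(`eliminable_regular`).

For a sentence there are no jets left: it is equivalent to an `L`-sentence, which the complete
theory `T` decides. -/

/-- Renaming of the variables of a field term. -/
def FieldTerm.rename {n n' : ℕ} (ρ : Fin n → Fin n') : FieldTerm L D n → FieldTerm L D n'
  | .var i => .var (ρ i)
  | .const c => .const c
  | .zero => .zero
  | .one => .one
  | .add s t => .add (s.rename ρ) (t.rename ρ)
  | .mul s t => .mul (s.rename ρ) (t.rename ρ)
  | .neg t => .neg (t.rename ρ)
  | .inv t => .inv (t.rename ρ)
  | .op d t => .op d (t.rename ρ)

theorem FieldTerm.eval_rename (M : Str L D) {n n' : ℕ} (ρ : Fin n → Fin n') (x : Fin n' → M.K)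
    (t : FieldTerm L D n) : (t.rename ρ).eval M x = t.eval M (x ∘ ρ) := by
  induction t with
  | var i => rfl
  | const c => rfl
  | zero => rfl
  | one => rfl
  | add s t hs ht => exact congrArg₂ _ hs ht
  | mul s t hs ht => exact congrArg₂ _ hs ht
  | neg t ht => exact congrArg _ ht
  | inv t ht => exact congrArg _ ht
  | op d t ht => exact congrArg _ ht

/-- Substitution of terms for the variables of a field term of the language `L`. -/
def FieldTerm.subst {n n' : ℕ} (σ : Fin n → FieldTerm L D n') :
    FieldTerm L Empty n → FieldTerm L D n'
  | .var i => σ i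
  | .const c => .const c
  | .zero => .zero
  | .one => .one
  | .add s t => .add (s.subst σ) (t.subst σ)
  | .mul s t => .mul (s.subst σ) (t.subst σ)
  | .neg t => .neg (t.subst σ)
  | .inv t => .inv (t.subst σ)
  | .op d _ => d.elim

/-- Substitution of terms for the field variables of an auxiliary term of the language `L`. -/
def AuxTerm.subst {n n' l : ℕ} {Δ : Fin l → L.Aux} (σ : Fin n → FieldTerm L D n') :
    {a : L.Aux} → AuxTerm L Empty n Δ a → AuxTerm L D n' Δ a
  | _, .var j => .var j
  | _, .app f s t => .app f (fun i => (s i).subst σ) (fun j => (t j).subst σ)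

/-- The extension of a substitution to one more variable. -/
def liftSubst {n n' : ℕ} (σ : Fin n → FieldTerm L D n') :
    Fin (n + 1) → FieldTerm L D (n' + 1) :=
  Fin.cons (.var 0) (fun i => (σ i).rename Fin.succ)

/-- Substitution of terms for the free field variables of a formula of the language `L`. -/
def Formula.subst : {n l : ℕ} → {Δ : Fin l → L.Aux} → Formula L Empty n Δ → {n' : ℕ} →
    (Fin n → FieldTerm L D n') → Formula L D n' Δ
  | _, _, _, .falsum, _, _ => .falsum
  | _, _, _, .eqField s t, _, σ => .eqField (s.subst σ) (t.subst σ)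
  | _, _, _, .eqAux s t, _, σ => .eqAux (s.subst σ) (t.subst σ)
  | _, _, _, .rel R s t, _, σ => .rel R (fun i => (s i).subst σ) (fun j => (t j).subst σ)
  | _, _, _, .imp φ ψ, _, σ => .imp (φ.subst σ) (ψ.subst σ)
  | _, _, _, .allField φ, _, σ => .allField (φ.subst (liftSubst σ))
  | _, _, _, .allAux a φ, _, σ => .allAux a (φ.subst σ)

/-- The reduct to `L` of a structure for any extension by unary functions. -/
def Str.baseReduct (M : Str L D) : Str L Empty where
  K := M.K
  aux := M.aux
  const := M.const
  func := M.func
  rel := M.rel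
  op := fun d => d.elim

theorem FieldTerm.eval_subst (M : Str L D) {n n' : ℕ} (σ : Fin n → FieldTerm L D n')
    (x : Fin n' → M.K) (t : FieldTerm L Empty n) :
    (t.subst σ).eval M x = t.eval M.baseReduct (fun i => (σ i).eval M x) := by
  induction t with
  | var i => rfl
  | const c => rfl
  | zero => rfl
  | one => rfl
  | add s t hs ht => exact congrArg₂ (fun a b : M.K => a + b) hs ht
  | mul s t hs ht => exact congrArg₂ (fun a b : M.K => a * b) hs ht
  | neg t ht => exact congrArg (fun a : M.K => -a) ht
  | inv t ht => exact congrArg (fun a : M.K => a⁻¹) ht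
  | op d t ht => exact d.elim

theorem AuxTerm.eval_subst (M : Str L D) {n n' l : ℕ} {Δ : Fin l → L.Aux}
    (σ : Fin n → FieldTerm L D n') (x : Fin n' → M.K) (w : ∀ j, M.aux (Δ j)) {a : L.Aux}
    (t : AuxTerm L Empty n Δ a) :
    (t.subst σ).eval M x w = t.eval M.baseReduct (fun i => (σ i).eval M x) w := by
  induction t with
  | var j => rfl
  | app f s t ht =>
    exact congrArg₂ (fun u v => M.func f u v)
      (funext fun i => (s i).eval_subst M σ x) (funext fun j => ht j)

theorem eval_liftSubst (M : Str L D) {n n' : ℕ} (σ : Fin n → FieldTerm L D n')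
    (x : Fin n' → M.K) (b : M.K) :
    (fun i => (liftSubst σ i).eval M (Fin.cons b x)) =
      (Fin.cons b (fun i => (σ i).eval M x) : Fin (n + 1) → M.K) := by
  funext i
  refine Fin.cases rfl (fun i => ?_) i
  simp only [liftSubst, Fin.cons_succ, FieldTerm.eval_rename]
  rfl

theorem Formula.realize_subst_baseReduct (M : Str L D) {n l : ℕ} {Δ : Fin l → L.Aux}
    (φ : Formula L Empty n Δ) : ∀ {n' : ℕ} (σ : Fin n → FieldTerm L D n') (x : Fin n' → M.K)
    (w : ∀ j, M.aux (Δ j)),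
    (φ.subst σ).Realize M x w ↔ φ.Realize M.baseReduct (fun i => (σ i).eval M x) w := by
  induction φ with
  | falsum => exact fun _ _ _ => Iff.rfl
  | eqField s t =>
    intro n' σ x w
    simp only [subst, Realize, FieldTerm.eval_subst]
    rfl
  | eqAux s t =>
    intro n' σ x w
    simp only [subst, Realize, AuxTerm.eval_subst]
    rfl
  | rel R s t =>
    intro n' σ x w
    simp only [subst, Realize, AuxTerm.eval_subst, FieldTerm.eval_subst]
    rfl
  | imp φ ψ hφ hψ => exact fun σ x w => imp_congr (hφ σ x w) (hψ σ x w)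
  | allField φ hφ =>
    intro n' σ x w
    refine forall_congr' fun b => (hφ (liftSubst σ) (Fin.cons b x) w).trans ?_
    rw [eval_liftSubst]
    rfl
  | allAux a φ hφ => exact fun σ x w => forall_congr' fun b => hφ σ x _

theorem Formula.realize_subst (M : Str L Empty) {n n' l : ℕ} {Δ : Fin l → L.Aux}
    (φ : Formula L Empty n Δ) (σ : Fin n → FieldTerm L Empty n') (x : Fin n' → M.K)
    (w : ∀ j, M.aux (Δ j)) :
    (φ.subst σ).Realize M x w ↔ φ.Realize M (fun i => (σ i).eval M x) w := by
  have h := φ.realize_subst_baseReduct M σ x w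
  obtain ⟨K, aux, const, func, rel, op⟩ := M
  -- There is only one family of operations indexed by `Empty`, so `M` is its own base reduct.
  obtain rfl : op = fun d => d.elim := funext fun d => d.elim
  exact h

theorem Formula.realize_subst_reduct (M : Str L Unit) {n n' l : ℕ} {Δ : Fin l → L.Aux}
    (φ : Formula L Empty n Δ) (σ : Fin n → FieldTerm L Unit n') (x : Fin n' → M.K)
    (w : ∀ j, M.aux (Δ j)) :
    (φ.subst σ).Realize M x w ↔ φ.Realize M.reduct (fun i => (σ i).eval M x) w :=
  φ.realize_subst_baseReduct M σ x w

theorem Formula.FieldQuantifierFree.subst {n l : ℕ} {Δ : Fin l → L.Aux}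
    {φ : Formula L Empty n Δ} (h : φ.FieldQuantifierFree) : ∀ {n' : ℕ}
    (σ : Fin n → FieldTerm L D n'), (φ.subst σ).FieldQuantifierFree := by
  induction φ with
  | falsum | eqField | eqAux | rel => exact fun _ => trivial
  | imp φ ψ hφ hψ => exact fun σ => ⟨hφ h.1 σ, hψ h.2 σ⟩
  | allField => exact h.elim
  | allAux a φ hφ => exact fun σ => hφ h σ

/-! ### Universal closure -/

theorem exists_allField_closure {l : ℕ} {Δ : Fin l → L.Aux} :
    ∀ {n : ℕ} (φ : Formula L D n Δ), ∃ ψ : Formula L D 0 Δ, ∀ (M : Str L D) x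
      (w : ∀ j, M.aux (Δ j)), ψ.Realize M x w ↔ ∀ y, φ.Realize M y w
  | 0, φ => ⟨φ, fun M x w => by
      refine ⟨fun h y => ?_, fun h => h _⟩
      rwa [Subsingleton.elim y x]⟩
  | n + 1, φ => by
      obtain ⟨ψ, hψ⟩ := exists_allField_closure (.allField φ)
      refine ⟨ψ, fun M x w => (hψ M x w).trans ?_⟩
      refine ⟨fun h y => ?_, fun h y b => h _⟩
      have := h (Fin.tail y) (y 0)
      rwa [Fin.cons_self_tail] at this

theorem exists_allAux_closure : ∀ {l : ℕ} {Δ : Fin l → L.Aux} (φ : Formula L D 0 Δ),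
    ∃ ψ : Sentence L D, ∀ M : Str L D, M.Satisfies ψ ↔ ∀ w, φ.Realize M Fin.elim0 w
  | 0, Δ, φ => by
      obtain rfl : Δ = Fin.elim0 := Subsingleton.elim _ _
      refine ⟨φ, fun M => ⟨fun h w => ?_, fun h => h _⟩⟩
      rwa [show w = fun j => j.elim0 from funext fun j => j.elim0]
  | l + 1, Δ, φ => by
      obtain ⟨a, Δ', rfl⟩ : ∃ a Δ', Δ = Fin.cons a Δ' := ⟨_, _, (Fin.cons_self_tail Δ).symm⟩
      obtain ⟨ψ, hψ⟩ := exists_allAux_closure (.allAux a φ)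
      refine ⟨ψ, fun M => (hψ M).trans ⟨fun h w => ?_, fun h w b => h _⟩⟩
      have := h (fun j => w j.succ) (w 0)
      convert this using 1
      funext j
      exact Fin.cases rfl (fun _ => rfl) j

/-- Every formula has a universal closure. -/
theorem exists_closure {n l : ℕ} {Δ : Fin l → L.Aux} (φ : Formula L D n Δ) :
    ∃ ψ : Sentence L D, ∀ M : Str L D, M.Satisfies ψ ↔ ∀ x w, φ.Realize M x w := by
  obtain ⟨φ', h'⟩ := exists_allField_closure φ
  obtain ⟨ψ, hψ⟩ := exists_allAux_closure φ'
  exact ⟨ψ, fun M => (hψ M).trans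
    ⟨fun h x w => (h' M _ w).1 (h w) x, fun h w => (h' M _ w).2 fun y => h y w⟩⟩

end GenericDerivation

/-! ### Term functions and definable predicates in infinitely many variables, and the open normal
form. -/

namespace GenericDerivation

variable {L : FieldLanguage.{u}}

/-! ### Term functions -/

/-- Functions of a possibly infinite tuple of field elements which are defined, uniformly in all
structures, by a field term of `L`. -/
inductive TermFun (L : FieldLanguage.{u}) (V : Type) :
    (∀ N : Str L Empty, (V → N.K) → N.K) → Prop
  | var (v : V) : TermFun L V (fun _ a => a v)
  | const (c : L.Const) : TermFun L V (fun N _ => N.const c)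
  | zero : TermFun L V (fun _ _ => 0)
  | one : TermFun L V (fun _ _ => 1)
  | add {f g} : TermFun L V f → TermFun L V g → TermFun L V (fun N a => f N a + g N a)
  | mul {f g} : TermFun L V f → TermFun L V g → TermFun L V (fun N a => f N a * g N a)
  | neg {f} : TermFun L V f → TermFun L V (fun N a => -f N a)
  | inv {f} : TermFun L V f → TermFun L V (fun N a => (f N a)⁻¹)

/-- Finitely many finite tuples of variables are contained in a single one. -/
theorem exists_common_variables {ι V : Type} [Fintype ι] (n : ι → ℕ)
    (e : ∀ i, Fin (n i) → V) :
    ∃ (m : ℕ) (e' : Fin m → V) (ρ : ∀ i, Fin (n i) → Fin m), ∀ i, e i = e' ∘ ρ i := by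
  let q := Fintype.equivFin (Σ i, Fin (n i))
  refine ⟨_, fun j => e (q.symm j).1 (q.symm j).2, fun i j => q ⟨i, j⟩, fun i => ?_⟩
  funext j
  change _ = (fun x : Σ i, Fin (n i) => e x.1 x.2) (q.symm (q ⟨i, j⟩))
  rw [q.symm_apply_apply]

theorem exists_common_variables₂ {V : Type} {n₁ n₂ : ℕ} (e₁ : Fin n₁ → V) (e₂ : Fin n₂ → V) :
    ∃ (m : ℕ) (e : Fin m → V) (ρ₁ : Fin n₁ → Fin m) (ρ₂ : Fin n₂ → Fin m),
      e₁ = e ∘ ρ₁ ∧ e₂ = e ∘ ρ₂ := by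
  obtain ⟨m, e, ρ, h⟩ := exists_common_variables (ι := Bool) (fun b => bif b then n₁ else n₂)
    (fun b => match b with | true => e₁ | false => e₂)
  exact ⟨m, e, ρ true, ρ false, h true, h false⟩

theorem TermFun.exists_term {V : Type} {f} (hf : TermFun L V f) :
    ∃ (n : ℕ) (e : Fin n → V) (t : FieldTerm L Empty n), ∀ N a, f N a = t.eval N (a ∘ e) := by
  induction hf with
  | var v => exact ⟨1, fun _ => v, .var 0, fun _ _ => rfl⟩
  | const c => exact ⟨0, Fin.elim0, .const c, fun _ _ => rfl⟩
  | zero => exact ⟨0, Fin.elim0, .zero, fun _ _ => rfl⟩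
  | one => exact ⟨0, Fin.elim0, .one, fun _ _ => rfl⟩
  | add _ _ hf hg =>
    obtain ⟨n₁, e₁, t₁, h₁⟩ := hf
    obtain ⟨n₂, e₂, t₂, h₂⟩ := hg
    obtain ⟨m, e, ρ₁, ρ₂, rfl, rfl⟩ := exists_common_variables₂ e₁ e₂
    refine ⟨m, e, .add (t₁.rename ρ₁) (t₂.rename ρ₂), fun N a => ?_⟩
    simp only [h₁, h₂, FieldTerm.eval, FieldTerm.eval_rename]
    rfl
  | mul _ _ hf hg =>
    obtain ⟨n₁, e₁, t₁, h₁⟩ := hf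
    obtain ⟨n₂, e₂, t₂, h₂⟩ := hg
    obtain ⟨m, e, ρ₁, ρ₂, rfl, rfl⟩ := exists_common_variables₂ e₁ e₂
    refine ⟨m, e, .mul (t₁.rename ρ₁) (t₂.rename ρ₂), fun N a => ?_⟩
    simp only [h₁, h₂, FieldTerm.eval, FieldTerm.eval_rename]
    rfl
  | neg _ hf =>
    obtain ⟨n, e, t, h⟩ := hf
    exact ⟨n, e, .neg t, fun N a => congrArg _ (h N a)⟩
  | inv _ hf =>
    obtain ⟨n, e, t, h⟩ := hf
    exact ⟨n, e, .inv t, fun N a => congrArg _ (h N a)⟩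

theorem TermFun.exists_terms {ι V : Type} [Fintype ι]
    {f : ι → ∀ N : Str L Empty, (V → N.K) → N.K} (hf : ∀ i, TermFun L V (f i)) :
    ∃ (n : ℕ) (e : Fin n → V) (t : ι → FieldTerm L Empty n),
      ∀ i N a, f i N a = (t i).eval N (a ∘ e) := by
  choose n e t h using fun i => (hf i).exists_term
  obtain ⟨m, e', ρ, hρ⟩ := exists_common_variables n e
  refine ⟨m, e', fun i => (t i).rename (ρ i), fun i N a => ?_⟩
  rw [h, FieldTerm.eval_rename, hρ]
  rfl

/-! ### Polynomials over `ℤ[Ω]` -/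

/-- The evaluation of polynomials over `ℤ[Ω]` at a tuple of field elements of a structure. -/
noncomputable def Str.evalPoly (N : Str L Empty) {V : Type} (a : V → N.K) :
    MvPolynomial V (MvPolynomial L.Const ℤ) →+* N.K :=
  MvPolynomial.eval₂Hom N.coeffHom a

theorem Str.evalPoly_X (N : Str L Empty) {V : Type} (a : V → N.K) (v : V) :
    N.evalPoly a (MvPolynomial.X v) = a v :=
  MvPolynomial.eval₂_X _ _ _

theorem Str.evalPoly_C (N : Str L Empty) {V : Type} (a : V → N.K) (c) :
    N.evalPoly a (MvPolynomial.C c) = N.coeffHom c :=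
  MvPolynomial.eval₂_C _ _ _

theorem Str.evalPoly_rename (N : Str L Empty) {V V' : Type} (ρ : V → V') (a : V' → N.K) (q) :
    N.evalPoly a (MvPolynomial.rename ρ q) = N.evalPoly (a ∘ ρ) q :=
  MvPolynomial.eval₂_rename _ _ _ _

theorem termFun_natCast (V : Type) (k : ℕ) : TermFun L V (fun _ _ => (k : ℕ)) := by
  induction k with
  | zero => simpa using TermFun.zero
  | succ k hk => simpa using hk.add .one

theorem termFun_coeffHom (V : Type) (c : MvPolynomial L.Const ℤ) :
    TermFun L V (fun N _ => N.coeffHom c) := by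
  induction c using MvPolynomial.induction_on with
  | C k =>
    obtain ⟨k, rfl | rfl⟩ := k.eq_nat_or_neg
    · simpa using termFun_natCast V k
    · simpa using (termFun_natCast V k).neg
  | add p q hp hq => simpa using hp.add hq
  | mul_X p c hp => simpa [Str.coeffHom] using hp.mul (.const c)

theorem termFun_evalPoly {V : Type} (q : MvPolynomial V (MvPolynomial L.Const ℤ)) :
    TermFun L V (fun N a => N.evalPoly a q) := by
  induction q using MvPolynomial.induction_on with
  | C c => simpa only [Str.evalPoly_C] using termFun_coeffHom V c
  | add p q hp hq => simpa using hp.add hq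
  | mul_X p v hp => simpa [Str.evalPoly_X] using hp.mul (.var v)

/-! ### Definable predicates -/

variable {T : Theory L Empty} {k : ℕ} {E : Fin k → L.Aux} {V V' U W : Type}

/-- A predicate of a possibly infinite tuple of field elements and a tuple of auxiliary elements
is definable modulo `T` if it is defined in all models of `T` by a single formula in finitely many
of the variables. -/
def Definable (T : Theory L Empty) {k : ℕ} (E : Fin k → L.Aux) (V : Type)
    (Φ : ∀ N : Str L Empty, (V → N.K) → (∀ j, N.aux (E j)) → Prop) : Prop :=
  ∃ (n : ℕ) (e : Fin n → V) (φ : Formula L Empty n E), ∀ N : Str L Empty, N.Models T →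
    ∀ a w, Φ N a w ↔ φ.Realize N (a ∘ e) w

namespace Definable

variable {Φ Ψ : ∀ N : Str L Empty, (V → N.K) → (∀ j, N.aux (E j)) → Prop}

theorem congr (h : Definable T E V Φ)
    (hΨ : ∀ N : Str L Empty, N.Models T → ∀ a w, Ψ N a w ↔ Φ N a w) : Definable T E V Ψ := by
  obtain ⟨n, e, φ, hφ⟩ := h
  exact ⟨n, e, φ, fun N hN a w => (hΨ N hN a w).trans (hφ N hN a w)⟩

theorem false : Definable T E V (fun _ _ _ => False) :=
  ⟨0, Fin.elim0, .falsum, fun _ _ _ _ => Iff.rfl⟩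

theorem imp (h₁ : Definable T E V Φ) (h₂ : Definable T E V Ψ) :
    Definable T E V (fun N a w => Φ N a w → Ψ N a w) := by
  obtain ⟨n₁, e₁, φ₁, h₁⟩ := h₁
  obtain ⟨n₂, e₂, φ₂, h₂⟩ := h₂
  obtain ⟨m, e, ρ₁, ρ₂, rfl, rfl⟩ := exists_common_variables₂ e₁ e₂
  refine ⟨m, e, .imp (φ₁.subst fun i => .var (ρ₁ i)) (φ₂.subst fun i => .var (ρ₂ i)),
    fun N hN a w => ?_⟩
  beta_reduce
  rw [h₁ N hN, h₂ N hN, Formula.Realize, Formula.realize_subst, Formula.realize_subst]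
  rfl

theorem not (h : Definable T E V Φ) : Definable T E V (fun N a w => ¬ Φ N a w) :=
  h.imp .false

theorem and (h₁ : Definable T E V Φ) (h₂ : Definable T E V Ψ) :
    Definable T E V (fun N a w => Φ N a w ∧ Ψ N a w) :=
  (h₁.imp h₂.not).not.congr fun _ _ _ _ => by tauto

theorem or (h₁ : Definable T E V Φ) (h₂ : Definable T E V Ψ) :
    Definable T E V (fun N a w => Φ N a w ∨ Ψ N a w) :=
  (h₁.not.imp h₂).congr fun _ _ _ _ => by tauto

theorem exists_list {ι : Type*}
    {Φ : ι → ∀ N : Str L Empty, (V → N.K) → (∀ j, N.aux (E j)) → Prop} (S : List ι)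
    (h : ∀ i ∈ S, Definable T E V (Φ i)) :
    Definable T E V (fun N a w => ∃ i ∈ S, Φ i N a w) := by
  induction S with
  | nil => exact false.congr fun _ _ _ _ => by simp
  | cons i S ih =>
    exact ((h i (by simp)).or (ih fun j hj => h j (by simp [hj]))).congr
      fun _ _ _ _ => by simp

theorem forall_list {ι : Type*}
    {Φ : ι → ∀ N : Str L Empty, (V → N.K) → (∀ j, N.aux (E j)) → Prop} (S : List ι)
    (h : ∀ i ∈ S, Definable T E V (Φ i)) :
    Definable T E V (fun N a w => ∀ i ∈ S, Φ i N a w) :=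
  (exists_list (Φ := fun i N a w => ¬ Φ i N a w) S fun i hi => (h i hi).not).not.congr
    fun _ _ _ _ => by simp

theorem eq {f g : ∀ N : Str L Empty, (V → N.K) → N.K} (hf : TermFun L V f)
    (hg : TermFun L V g) : Definable T E V (fun N a _ => f N a = g N a) := by
  obtain ⟨n₁, e₁, t₁, h₁⟩ := hf.exists_term
  obtain ⟨n₂, e₂, t₂, h₂⟩ := hg.exists_term
  obtain ⟨m, e, ρ₁, ρ₂, rfl, rfl⟩ := exists_common_variables₂ e₁ e₂
  refine ⟨m, e, .eqField (t₁.rename ρ₁) (t₂.rename ρ₂), fun N hN a w => ?_⟩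
  beta_reduce
  rw [h₁, h₂, Formula.Realize, FieldTerm.eval_rename, FieldTerm.eval_rename]
  rfl

theorem evalPoly_eq_zero (q : MvPolynomial V (MvPolynomial L.Const ℤ)) :
    Definable T E V (fun N a _ => N.evalPoly a q = 0) :=
  eq (termFun_evalPoly q) .zero

theorem comp (h : Definable T E V Φ) {g : V → ∀ N : Str L Empty, (V' → N.K) → N.K}
    (hg : ∀ v, TermFun L V' (g v)) :
    Definable T E V' (fun N a w => Φ N (fun v => g v N a) w) := by
  obtain ⟨n, e, φ, h⟩ := h
  obtain ⟨m, e', t, ht⟩ := TermFun.exists_terms fun i => hg (e i)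
  refine ⟨m, e', φ.subst t, fun N hN a w => ?_⟩
  beta_reduce
  rw [h N hN, Formula.realize_subst]
  simp only [← ht]
  rfl

theorem comp_map (h : Definable T E V Φ) (ρ : V → V') :
    Definable T E V' (fun N a w => Φ N (a ∘ ρ) w) :=
  h.comp (g := fun v _ a => a (ρ v)) fun v => .var (ρ v)

end Definable

/-- Quantification over a block of field variables. -/
theorem exists_block (r : ℕ) : ∀ {n s : ℕ} (φ : Formula L Empty n E) (f : Fin n → Fin r ⊕ Fin s),
    ∃ ψ : Formula L Empty s E, ∀ (N : Str L Empty) b w,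
      ψ.Realize N b w ↔ ∃ c : Fin r → N.K, φ.Realize N (Sum.elim c b ∘ f) w := by
  induction r with
  | zero =>
    intro n s φ f
    refine ⟨φ.subst fun i => .var ((f i).elim Fin.elim0 id), fun N b w => ?_⟩
    rw [Formula.realize_subst]
    have key : ∀ c : Fin 0 → N.K, Sum.elim c b ∘ f =
        fun i => FieldTerm.eval N b (.var ((f i).elim Fin.elim0 id)) := by
      intro c
      funext i
      simp only [Function.comp, FieldTerm.eval]
      rcases f i with j | j
      · exact j.elim0
      · rfl
    exact ⟨fun h => ⟨Fin.elim0, by rwa [key]⟩, fun ⟨c, h⟩ => by rwa [key] at h⟩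
  | succ r ih =>
    intro n s φ f
    -- The first variable of the block becomes the free variable `0`, which is quantified after the
    -- other `r`.
    obtain ⟨ψ, hψ⟩ := ih φ (s := s + 1)
      (fun i => (f i).elim (Fin.cases (Sum.inr 0) Sum.inl) (Sum.inr ∘ Fin.succ))
    refine ⟨.imp (.allField (.imp ψ .falsum)) .falsum, fun N b w => ?_⟩
    have key : ∀ (c : Fin r → N.K) (c₀ : N.K),
        Sum.elim c (Fin.cons c₀ b : Fin (s + 1) → N.K) ∘
          (fun i => (f i).elim (Fin.cases (Sum.inr 0) Sum.inl) (Sum.inr ∘ Fin.succ)) =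
        Sum.elim (Fin.cons c₀ c : Fin (r + 1) → N.K) b ∘ f := by
      intro c c₀
      funext i
      simp only [Function.comp]
      rcases f i with j | j
      · exact Fin.cases rfl (fun _ => rfl) j
      · rfl
    simp only [Formula.Realize, hψ, key]
    constructor
    · intro h
      by_contra! h'
      exact h fun c₀ ⟨c, hc⟩ => h' _ hc
    · rintro ⟨c, hc⟩ h
      exact h (c 0) ⟨Fin.tail c, by rwa [Fin.cons_self_tail]⟩

/-- Injectivity of `e₁` ensures that values prescribed at the finitely many variables from `U`
extend to a whole tuple. -/
theorem exists_sum_factorization {n : ℕ} (e : Fin n → U ⊕ W) :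
    ∃ (r s : ℕ) (e₁ : Fin r → U) (e₂ : Fin s → W) (f : Fin n → Fin r ⊕ Fin s),
      Function.Injective e₁ ∧ e = Sum.map e₁ e₂ ∘ f := by
  classical
  let A := {u : U // ∃ i, e i = Sum.inl u}
  let B := {v : W // ∃ i, e i = Sum.inr v}
  have hA : Finite A := Finite.of_injective (fun u : A => u.2.choose) fun u v h => by
    have h' : u.2.choose = v.2.choose := h
    have := u.2.choose_spec
    rw [h', v.2.choose_spec] at this
    exact Subtype.ext (Sum.inl_injective this).symm
  have hB : Finite B := Finite.of_injective (fun u : B => u.2.choose) fun u v h => by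
    have h' : u.2.choose = v.2.choose := h
    have := u.2.choose_spec
    rw [h', v.2.choose_spec] at this
    exact Subtype.ext (Sum.inr_injective this).symm
  have hf : ∀ i, ∃ x : A ⊕ B, e i = Sum.map Subtype.val Subtype.val x := by
    intro i
    rcases h : e i with u | v
    · exact ⟨.inl ⟨u, i, h⟩, rfl⟩
    · exact ⟨.inr ⟨v, i, h⟩, rfl⟩
  choose f hf using hf
  refine ⟨Nat.card A, Nat.card B, fun i => ((Finite.equivFin A).symm i).1,
    fun i => ((Finite.equivFin B).symm i).1,
    fun i => Sum.map (Finite.equivFin A) (Finite.equivFin B) (f i),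
    Subtype.val_injective.comp (Equiv.injective _), funext fun i => ?_⟩
  rw [hf i]
  simp only [Function.comp]
  rcases f i with u | v <;> simp

/-- A definable predicate depends on finitely many coordinates, so quantifying over the possibly
infinite tuple `u` amounts to quantifying over a finite block. -/
theorem Definable.exists_sum
    {Φ : ∀ N : Str L Empty, (U ⊕ W → N.K) → (∀ j, N.aux (E j)) → Prop}
    (h : Definable T E (U ⊕ W) Φ) :
    Definable T E W (fun N b w => ∃ u : U → N.K, Φ N (Sum.elim u b) w) := by
  obtain ⟨n, e, φ, h⟩ := h
  obtain ⟨r, s, e₁, e₂, f, he₁, rfl⟩ := exists_sum_factorization e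
  obtain ⟨ψ, hψ⟩ := exists_block r φ f
  refine ⟨s, e₂, ψ, fun N hN b w => ?_⟩
  simp only [h N hN, hψ]
  have key : ∀ u : U → N.K, Sum.elim u b ∘ Sum.map e₁ e₂ ∘ f =
      Sum.elim (u ∘ e₁) (b ∘ e₂) ∘ f := by
    intro u
    rw [← Function.comp_assoc, Sum.elim_comp_map]
  simp only [key]
  constructor
  · rintro ⟨u, hu⟩
    exact ⟨_, hu⟩
  · rintro ⟨c, hc⟩
    refine ⟨Function.extend e₁ c 0, ?_⟩
    rwa [Function.extend_comp he₁]

/-- The open normal form of definable predicates in open theories of topological fields. -/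
theorem Definable.exists_open_form {p l : ℕ} {Δ : Fin l → L.Aux}
    {χ : Formula L Empty (p + 1) Δ} (hT : IsOpenTheory T χ)
    {Φ : ∀ N : Str L Empty, (V → N.K) → (∀ j, N.aux (E j)) → Prop} (h : Definable T E V Φ) :
    ∃ (r : ℕ) (Q : Fin r → List (MvPolynomial V (MvPolynomial L.Const ℤ)))
      (Θ : Fin r → ∀ N : Str L Empty, (V → N.K) → (∀ j, N.aux (E j)) → Prop),
      (∀ i, Definable T E V (Θ i) ∧ ∀ N : Str L Empty, N.Models T → ∀ a w, Θ i N a w →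
        ∃ z, ∀ a' : V → N.K, (∀ v, a' v - a v ∈ basicSet N χ z) → Θ i N a' w) ∧
      ∀ N : Str L Empty, N.Models T → ∀ a w, Φ N a w ↔
        ∃ i, (∀ q ∈ Q i, N.evalPoly a q = 0) ∧ Θ i N a w := by
  obtain ⟨n, e, φ, h⟩ := h
  obtain ⟨ψ, hψ, hφψ⟩ := hT.eliminates n k E φ
  obtain ⟨S, hS, hψS⟩ := hT.openForm n k E ψ hψ
  refine ⟨S.length, fun i => (S.get i).1.map (MvPolynomial.rename e),
    fun i N a w => (S.get i).2.Realize N (a ∘ e) w, fun i => ⟨⟨n, e, (S.get i).2, fun _ _ _ _ =>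
      Iff.rfl⟩, fun N hN a w ha => ?_⟩, fun N hN a w => ?_⟩
  · obtain ⟨z, hz⟩ := (hS _ (S.get_mem i) N hN).2 w (a ∘ e) ha
    exact ⟨z, fun a' ha' => hz (a' ∘ e) fun j => ha' (e j)⟩
  · rw [h N hN, hφψ N hN, hψS N hN]
    have key : ∀ d : List (MvPolynomial (Fin n) (MvPolynomial L.Const ℤ)),
        (∀ q ∈ d.map (MvPolynomial.rename e), N.evalPoly a q = 0) ↔
          ∀ P ∈ d, P.eval₂ N.coeffHom (a ∘ e) = 0 := by
      intro d
      simp only [List.forall_mem_map, Str.evalPoly_rename]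
      rfl
    constructor
    · rintro ⟨d, hd, h₁, h₂⟩
      obtain ⟨i, rfl⟩ := List.get_of_mem hd
      exact ⟨i, (key _).2 h₁, h₂⟩
    · rintro ⟨i, h₁, h₂⟩
      exact ⟨_, S.get_mem i, (key _).1 h₁, h₂⟩

end GenericDerivation

/-! ### Pseudo-division, polynomials in jets, and derivatives at regular zeros. -/

namespace GenericDerivation

open Polynomial in
/-- Pseudo-division of polynomials over a commutative ring. -/
theorem exists_pseudo_division {R : Type*} [CommRing R] (p : R[X]) {d : ℕ} (hd : 0 < d)
    (hp : p.natDegree ≤ d) (q : R[X]) :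
    ∃ (k : ℕ) (s r : R[X]), C (p.coeff d) ^ k * q = s * p + r ∧ r.natDegree < d := by
  induction h : q.natDegree using Nat.strong_induction_on generalizing q with
  | _ n ih =>
    rcases lt_or_ge n d with hn | hn
    · exact ⟨0, 0, q, by simp, h ▸ hn⟩
    · let q' := C (p.coeff d) * q - C (q.coeff n) * X ^ (n - d) * p
      have hq' : q'.natDegree < n := by
        have hle : q'.natDegree ≤ n := by
          refine (natDegree_sub_le _ _).trans
            (max_le ((natDegree_C_mul_le _ _).trans h.le) ?_)
          refine natDegree_mul_le.trans ?_
          have := natDegree_C_mul_X_pow_le (q.coeff n) (n - d)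
          omega
        refine lt_of_le_of_ne hle fun heq => ?_
        have hc : q'.coeff n = 0 := by
          have h1 : (C (q.coeff n) * X ^ (n - d) * p).coeff n = q.coeff n * p.coeff d := by
            rw [mul_assoc, coeff_C_mul, mul_comm (X ^ _), coeff_mul_X_pow', if_pos (by omega)]
            congr 2
            omega
          simp only [q', coeff_sub, coeff_C_mul, h1]
          ring
        have h0 : q' = 0 := by
          rw [← leadingCoeff_eq_zero, leadingCoeff, heq, hc]
        -- The zero polynomial has `natDegree` zero, hence the need for `0 < d ≤ n`.
        rw [h0, natDegree_zero] at heq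
        omega
      obtain ⟨k, s, r, hs, hr⟩ := ih _ hq' q' rfl
      refine ⟨k + 1, s + C (p.coeff d) ^ k * (C (q.coeff n) * X ^ (n - d)), r, ?_, hr⟩
      have : C (p.coeff d) ^ (k + 1) * q = C (p.coeff d) ^ k * q' +
          C (p.coeff d) ^ k * (C (q.coeff n) * X ^ (n - d)) * p := by
        simp only [q']
        ring
      rw [this, hs]
      ring

variable {L : FieldLanguage.{u}} {W : Type}

/-! ### Polynomials in jets -/

/-- Polynomials over `ℤ[Ω]` in the successive derivatives `inl 0, inl 1, …` of one element and in
parameters `W`. -/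
abbrev JetPoly (L : FieldLanguage.{u}) (W : Type) : Type u :=
  MvPolynomial (ℕ ⊕ W) (MvPolynomial L.Const ℤ)

/-- The polynomials of order less than `m`. -/
noncomputable def orderLT (L : FieldLanguage.{u}) (W : Type) (m : ℕ) :
    Subalgebra (MvPolynomial L.Const ℤ) (JetPoly L W) :=
  MvPolynomial.supported _ {v | ∀ j, v = Sum.inl j → j < m}

theorem X_inl_mem_orderLT {m j : ℕ} (h : j < m) :
    (MvPolynomial.X (Sum.inl j) : JetPoly L W) ∈ orderLT L W m :=
  Algebra.subset_adjoin ⟨.inl j, fun _ hi => Sum.inl_injective hi ▸ h, rfl⟩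

theorem X_inr_mem_orderLT (m : ℕ) (v : W) :
    (MvPolynomial.X (Sum.inr v) : JetPoly L W) ∈ orderLT L W m :=
  Algebra.subset_adjoin ⟨.inr v, fun _ hi => (Sum.inr_ne_inl hi).elim, rfl⟩

@[elab_as_elim]
theorem orderLT_induction {m : ℕ} {P : ∀ q : JetPoly L W, q ∈ orderLT L W m → Prop}
    (inl : ∀ j (hj : j < m), P (.X (.inl j)) (X_inl_mem_orderLT hj))
    (inr : ∀ v, P (.X (.inr v)) (X_inr_mem_orderLT m v))
    (C : ∀ c, P (.C c) ((orderLT L W m).algebraMap_mem c))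
    (add : ∀ q r hq hr, P q hq → P r hr → P (q + r) (add_mem hq hr))
    (mul : ∀ q r hq hr, P q hq → P r hr → P (q * r) (mul_mem hq hr))
    {q : JetPoly L W} (hq : q ∈ orderLT L W m) : P q hq := by
  unfold orderLT MvPolynomial.supported at hq
  induction hq using Algebra.adjoin_induction with
  | mem x hx =>
    obtain ⟨v, hv, rfl⟩ := hx
    rcases v with j | v
    · exact inl j (hv j rfl)
    · exact inr v
  | algebraMap c => exact C c
  | add x y hx hy ihx ihy => exact add _ _ hx hy ihx ihy
  | mul x y hx hy ihx ihy => exact mul _ _ hx hy ihx ihy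

theorem orderLT_mono {m m' : ℕ} (h : m ≤ m') : orderLT L W m ≤ orderLT L W m' :=
  MvPolynomial.supported_mono fun _ hv j hj => (hv j hj).trans_le h

theorem rename_mem_orderLT {m : ℕ}
    (q : MvPolynomial (Fin m ⊕ W) (MvPolynomial L.Const ℤ)) :
    MvPolynomial.rename (Sum.map Fin.val id) q ∈ orderLT L W m := by
  induction q using MvPolynomial.induction_on with
  | C c =>
    rw [MvPolynomial.rename_C]
    exact (orderLT L W m).algebraMap_mem c
  | add p q hp hq =>
    rw [map_add]
    exact add_mem hp hq
  | mul_X p v hp =>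
    rw [map_mul, MvPolynomial.rename_X]
    refine mul_mem hp ?_
    rcases v with j | v
    · exact X_inl_mem_orderLT j.2
    · exact X_inr_mem_orderLT m v

theorem exists_rename_eq {m : ℕ} {q : JetPoly L W} (hq : q ∈ orderLT L W m) :
    ∃ q' : MvPolynomial (Fin m ⊕ W) (MvPolynomial L.Const ℤ),
      MvPolynomial.rename (Sum.map Fin.val id) q' = q := by
  induction hq using orderLT_induction with
  | inl j hj => exact ⟨.X (.inl ⟨j, hj⟩), MvPolynomial.rename_X _ _⟩
  | inr v => exact ⟨.X (.inr v), MvPolynomial.rename_X _ _⟩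
  | C c => exact ⟨.C c, MvPolynomial.rename_C _ _⟩
  | add q r _ _ hq hr =>
    obtain ⟨q', rfl⟩ := hq
    obtain ⟨r', rfl⟩ := hr
    exact ⟨q' + r', map_add _ _ _⟩
  | mul q r _ _ hq hr =>
    obtain ⟨q', rfl⟩ := hq
    obtain ⟨r', rfl⟩ := hr
    exact ⟨q' * r', map_mul _ _ _⟩

/-- A univariate polynomial over the polynomials of order less than `m`, viewed as a polynomial of
order at most `m`. -/
noncomputable def toJetPoly (m : ℕ) : Polynomial (orderLT L W m) →+* JetPoly L W :=
  Polynomial.eval₂RingHom (algebraMap (orderLT L W m) (JetPoly L W)) (.X (.inl m))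

theorem toJetPoly_C (m : ℕ) (c : orderLT L W m) : toJetPoly m (.C c) = c :=
  Polynomial.eval₂_C _ _

theorem toJetPoly_X (m : ℕ) : toJetPoly m (.X : Polynomial (orderLT L W m)) = .X (.inl m) :=
  Polynomial.eval₂_X _ _

theorem toJetPoly_mem (m : ℕ) (p : Polynomial (orderLT L W m)) :
    toJetPoly m p ∈ orderLT L W (m + 1) := by
  induction p using Polynomial.induction_on' with
  | add p q hp hq =>
    rw [map_add]
    exact add_mem hp hq
  | monomial n a =>
    rw [← Polynomial.C_mul_X_pow_eq_monomial, map_mul, map_pow, toJetPoly_C, toJetPoly_X]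
    exact mul_mem (orderLT_mono (Nat.le_succ m) a.2)
      (pow_mem (X_inl_mem_orderLT (Nat.lt_succ_self m)) n)

theorem exists_toJetPoly_eq {m : ℕ} {q : JetPoly L W} (hq : q ∈ orderLT L W (m + 1)) :
    ∃ p : Polynomial (orderLT L W m), toJetPoly m p = q := by
  induction hq using orderLT_induction with
  | inl j hj =>
    rcases (Nat.lt_succ_iff_lt_or_eq.1 hj) with hj | rfl
    · exact ⟨.C ⟨_, X_inl_mem_orderLT hj⟩, toJetPoly_C _ _⟩
    · exact ⟨.X, toJetPoly_X _⟩
  | inr v => exact ⟨.C ⟨_, X_inr_mem_orderLT m v⟩, toJetPoly_C _ _⟩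
  | C c => exact ⟨.C ⟨_, (orderLT L W m).algebraMap_mem c⟩, toJetPoly_C _ _⟩
  | add q r _ _ hq hr =>
    obtain ⟨q', rfl⟩ := hq
    obtain ⟨r', rfl⟩ := hr
    exact ⟨q' + r', map_add _ _ _⟩
  | mul q r _ _ hq hr =>
    obtain ⟨q', rfl⟩ := hq
    obtain ⟨r', rfl⟩ := hr
    exact ⟨q' * r', map_mul _ _ _⟩

theorem evalPoly_toJetPoly (N : Str L Empty) (a : ℕ ⊕ W → N.K) {m n : ℕ}
    {p : Polynomial (orderLT L W m)} (hp : p.natDegree < n) :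
    N.evalPoly a (toJetPoly m p) =
      ∑ i ∈ Finset.range n, N.evalPoly a (p.coeff i : JetPoly L W) * a (.inl m) ^ i := by
  rw [toJetPoly, Polynomial.coe_eval₂RingHom, Polynomial.hom_eval₂,
    Polynomial.eval₂_eq_sum_range' _ hp, N.evalPoly_X]
  rfl

/-- The value of a polynomial of order less than `m` depends only on the first `m` variables. -/
theorem evalPoly_congr (N : Str L Empty) {m : ℕ} {q : JetPoly L W} (hq : q ∈ orderLT L W m)
    {a a' : ℕ ⊕ W → N.K} (hl : ∀ j < m, a (.inl j) = a' (.inl j))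
    (hr : ∀ v, a (.inr v) = a' (.inr v)) : N.evalPoly a q = N.evalPoly a' q := by
  induction hq using orderLT_induction with
  | inl j hj => simpa only [Str.evalPoly_X] using hl j hj
  | inr v => simpa only [Str.evalPoly_X] using hr v
  | C c => simp only [Str.evalPoly_C]
  | add q r _ _ hq hr => rw [map_add, map_add, hq, hr]
  | mul q r _ _ hq hr => rw [map_mul, map_mul, hq, hr]

/-- The truncation of a polynomial at degree `i`. -/
noncomputable def truncate {R : Type*} [Semiring R] (p : Polynomial R) (i : ℕ) : Polynomial R :=
  ∑ j ∈ Finset.range (i + 1), Polynomial.monomial j (p.coeff j)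

theorem coeff_truncate {R : Type*} [Semiring R] (p : Polynomial R) (i j : ℕ) :
    (truncate p i).coeff j = if j < i + 1 then p.coeff j else 0 := by
  simp [truncate, Polynomial.coeff_monomial]

theorem natDegree_truncate_le {R : Type*} [Semiring R] (p : Polynomial R) (i : ℕ) :
    (truncate p i).natDegree ≤ i := by
  rw [Polynomial.natDegree_le_iff_coeff_eq_zero]
  intro j hj
  rw [coeff_truncate, if_neg (by omega)]

/-- Cut at the largest `i` whose coefficient does not vanish at `a`: the discarded terms are zero
there. This turns an equation into one whose leading coefficient is non-zero at the point
considered. -/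
theorem exists_evalPoly_truncate_eq (N : Str L Empty) (a : ℕ ⊕ W → N.K) {m n : ℕ}
    {p : Polynomial (orderLT L W m)} (hp : p.natDegree < n)
    (h : ∃ i < n, N.evalPoly a (p.coeff i : JetPoly L W) ≠ 0) :
    ∃ i < n, N.evalPoly a ((truncate p i).coeff i : JetPoly L W) ≠ 0 ∧
      N.evalPoly a (toJetPoly m (truncate p i)) = N.evalPoly a (toJetPoly m p) := by
  classical
  let s := (Finset.range n).filter fun i => N.evalPoly a (p.coeff i : JetPoly L W) ≠ 0
  have hs : s.Nonempty := by
    obtain ⟨i, hi, h⟩ := h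
    exact ⟨i, by simp [s, hi, h]⟩
  obtain ⟨hn, hc⟩ := Finset.mem_filter.1 (s.max'_mem hs)
  refine ⟨s.max' hs, Finset.mem_range.1 hn, by rwa [coeff_truncate, if_pos (Nat.lt_succ_self _)],
    ?_⟩
  rw [evalPoly_toJetPoly N a hp, evalPoly_toJetPoly N a
    ((natDegree_truncate_le p _).trans_lt (Finset.mem_range.1 hn))]
  refine Finset.sum_congr rfl fun j hj => ?_
  rw [coeff_truncate]
  split_ifs with h'
  · rfl
  · have : N.evalPoly a (p.coeff j : JetPoly L W) = 0 := by
      by_contra hne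
      exact h' (Nat.lt_succ_of_le (s.le_max' j (Finset.mem_filter.2 ⟨hj, hne⟩)))
    rw [this]
    simp

/-! ### Derivations on structures -/

/-- `d` is a derivation of the field sort of `N` vanishing on the constants from Ω. -/
structure IsDerivationOn (N : Str L Empty) (d : N.K → N.K) : Prop where
  add : ∀ x y, d (x + y) = d x + d y
  mul : ∀ x y, d (x * y) = d x * y + x * d y
  const : ∀ c, d (N.const c) = 0

namespace IsDerivationOn

variable {N : Str L Empty} {d : N.K → N.K} (h : IsDerivationOn N d)
include h

theorem zero : d 0 = 0 := by
  simpa using h.add 0 0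

theorem one : d 1 = 0 := by
  simpa using h.mul 1 1

theorem neg (x : N.K) : d (-x) = -d x := by
  have := h.add x (-x)
  rw [add_neg_cancel, h.zero] at this
  exact (neg_eq_of_add_eq_zero_right this.symm).symm

/-- Thanks to `0⁻¹ = 0`, the usual formula holds at `x = 0` as well, so terms can be differentiated
without case distinctions. -/
theorem inv (x : N.K) : d x⁻¹ = -(d x * (x⁻¹ * x⁻¹)) := by
  by_cases hx : x = 0
  · simp [hx, h.zero]
  · have := h.mul x x⁻¹
    rw [mul_inv_cancel₀ hx, h.one] at this
    field_simp
    field_simp at this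
    linear_combination -this

theorem natCast (k : ℕ) : d k = 0 := by
  induction k with
  | zero => simpa using h.zero
  | succ k hk => rw [Nat.cast_succ, h.add, hk, h.one, add_zero]

theorem coeffHom (c : MvPolynomial L.Const ℤ) : d (N.coeffHom c) = 0 := by
  induction c using MvPolynomial.induction_on with
  | C k =>
    obtain ⟨k, rfl | rfl⟩ := k.eq_nat_or_neg
    · simpa using h.natCast k
    · simpa [h.neg] using h.natCast k
  | add p q hp hq => rw [map_add, h.add, hp, hq, add_zero]
  | mul_X p c hp =>
    have : N.coeffHom (.X c) = N.const c := by simp [Str.coeffHom]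
    rw [map_mul, h.mul, hp, this, h.const]
    simp

end IsDerivationOn

/-- If the derivatives of the variables are given by term functions on a class of tuples, then so
are the derivatives of term functions. -/
theorem TermFun.exists_derivative {V : Type}
    {P : ∀ N : Str L Empty, (N.K → N.K) → (V → N.K) → Prop}
    (hP : ∀ N d a, P N d a → IsDerivationOn N d)
    (hvar : ∀ v, ∃ g, TermFun L V g ∧ ∀ N d a, P N d a → d (a v) = g N a)
    {f} (hf : TermFun L V f) :
    ∃ g, TermFun L V g ∧ ∀ N d a, P N d a → d (f N a) = g N a := by
  induction hf with
  | var v => exact hvar v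
  | const c => exact ⟨_, .zero, fun N d a h => (hP N d a h).const c⟩
  | zero => exact ⟨_, .zero, fun N d a h => (hP N d a h).zero⟩
  | one => exact ⟨_, .zero, fun N d a h => (hP N d a h).one⟩
  | add _ _ h₁ h₂ =>
    obtain ⟨g₁, hg₁, h₁⟩ := h₁
    obtain ⟨g₂, hg₂, h₂⟩ := h₂
    exact ⟨_, hg₁.add hg₂, fun N d a h => by rw [(hP N d a h).add, h₁ N d a h, h₂ N d a h]⟩
  | mul hf₁ hf₂ h₁ h₂ =>
    obtain ⟨g₁, hg₁, h₁⟩ := h₁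
    obtain ⟨g₂, hg₂, h₂⟩ := h₂
    exact ⟨_, (hg₁.mul hf₂).add (hf₁.mul hg₂), fun N d a h => by
      rw [(hP N d a h).mul, h₁ N d a h, h₂ N d a h]⟩
  | neg _ h =>
    obtain ⟨g, hg, h'⟩ := h
    exact ⟨_, hg.neg, fun N d a h => by rw [(hP N d a h).neg, h' N d a h]⟩
  | inv hf h =>
    obtain ⟨g, hg, h'⟩ := h
    exact ⟨_, (hg.mul (hf.inv.mul hf.inv)).neg, fun N d a h => by
      rw [(hP N d a h).inv, h' N d a h]⟩

/-! ### Jets -/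

/-- The tuple consisting of the successive derivatives of `x` and of the parameters `b`. -/
def jet {N : Str L Empty} (d : N.K → N.K) (x : N.K) (b : W → N.K) : ℕ ⊕ W → N.K :=
  Sum.elim (fun j => d^[j] x) b

/-- `d` is a derivation and maps the parameter of index `v` to the one of index `s v`. -/
structure IsCompatible (s : W → W) (N : Str L Empty) (d : N.K → N.K) (b : W → N.K) : Prop where
  derivation : IsDerivationOn N d
  param : ∀ v, d (b v) = b (s v)

/-- The derivative of a jet variable or of a parameter is another such variable, and elements of
`ℤ[Ω]` are constants. The Leibniz rule does the rest. -/
theorem exists_derivative_evalPoly (s : W → W) {m : ℕ} {q : JetPoly L W}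
    (hq : q ∈ orderLT L W m) : ∃ G ∈ orderLT L W (m + 1), ∀ (N : Str L Empty) (d : N.K → N.K) x b,
      IsCompatible s N d b → d (N.evalPoly (jet d x b) q) = N.evalPoly (jet d x b) G := by
  induction hq using orderLT_induction with
  | inl j hj =>
    refine ⟨_, X_inl_mem_orderLT (Nat.succ_lt_succ hj), fun N d x b h => ?_⟩
    rw [N.evalPoly_X, N.evalPoly_X]
    exact (Function.iterate_succ_apply' d j x).symm
  | inr v =>
    refine ⟨_, X_inr_mem_orderLT (m + 1) (s v), fun N d x b h => ?_⟩
    rw [N.evalPoly_X, N.evalPoly_X]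
    exact h.param v
  | C c =>
    refine ⟨0, zero_mem _, fun N d x b h => ?_⟩
    rw [N.evalPoly_C, h.derivation.coeffHom, map_zero]
  | add q r _ _ hq hr =>
    obtain ⟨G, hG, hq⟩ := hq
    obtain ⟨H, hH, hr⟩ := hr
    refine ⟨G + H, add_mem hG hH, fun N d x b h => ?_⟩
    rw [map_add, map_add, h.derivation.add, hq N d x b h, hr N d x b h]
  | mul q r hqm hrm hq hr =>
    obtain ⟨G, hG, hq⟩ := hq
    obtain ⟨H, hH, hr⟩ := hr
    refine ⟨G * r + q * H, add_mem (mul_mem hG (orderLT_mono (Nat.le_succ m) hrm))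
      (mul_mem (orderLT_mono (Nat.le_succ m) hqm) hH), fun N d x b h => ?_⟩
    rw [map_mul, map_add, map_mul, map_mul, h.derivation.mul, hq N d x b h, hr N d x b h]

/-- The chain rule: `δ^(m+1) x` occurs linearly, with the separant as coefficient, and everything
else has order at most `m`. -/
theorem exists_derivative_toJetPoly (s : W → W) {m : ℕ} (p : Polynomial (orderLT L W m)) :
    ∃ G ∈ orderLT L W (m + 1), ∀ (N : Str L Empty) (d : N.K → N.K) x b, IsCompatible s N d b →
      d (N.evalPoly (jet d x b) (toJetPoly m p)) =
        N.evalPoly (jet d x b) (toJetPoly m p.derivative) * d^[m + 1] x +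
          N.evalPoly (jet d x b) G := by
  induction p using Polynomial.induction_on' with
  | add p q hp hq =>
    obtain ⟨G, hG, hp⟩ := hp
    obtain ⟨H, hH, hq⟩ := hq
    refine ⟨G + H, add_mem hG hH, fun N d x b h => ?_⟩
    simp only [map_add, h.derivation.add, hp N d x b h, hq N d x b h]
    ring
  | monomial n a =>
    induction n with
    | zero =>
      obtain ⟨G, hG, h⟩ := exists_derivative_evalPoly s a.2
      refine ⟨G, hG, fun N d x b hb => ?_⟩
      rw [Polynomial.monomial_zero_left, toJetPoly_C, h N d x b hb]
      simp
    | succ n ih =>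
      obtain ⟨G, hG, h⟩ := ih
      refine ⟨G * .X (.inl m), mul_mem hG (X_inl_mem_orderLT (Nat.lt_succ_self m)),
        fun N d x b hb => ?_⟩
      have hX : N.evalPoly (jet d x b) (.X (.inl m)) = d^[m] x := N.evalPoly_X _ _
      rw [← Polynomial.monomial_mul_X, Polynomial.derivative_mul, map_mul, map_mul,
        hb.derivation.mul, h N d x b hb, toJetPoly_X, hX, ← Function.iterate_succ_apply' d m x,
        Polynomial.derivative_X, mul_one, map_add, map_add, map_mul, map_mul, map_mul,
        toJetPoly_X, hX]
      ring

/-- At the zeros of a polynomial of order `m` which are not zeros of the separant, all derivatives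
are term functions of the derivatives of order at most `m`. -/
theorem exists_termFun_iterate (s : W → W) {m : ℕ} (p : Polynomial (orderLT L W m)) (j : ℕ) :
    ∃ f, TermFun L (Fin (m + 1) ⊕ W) f ∧ ∀ (N : Str L Empty) (d : N.K → N.K) x b,
      IsCompatible s N d b → N.evalPoly (jet d x b) (toJetPoly m p) = 0 →
      N.evalPoly (jet d x b) (toJetPoly m p.derivative) ≠ 0 →
      d^[j] x = f N (jet d x b ∘ Sum.map Fin.val id) := by
  -- The class of truncated jets at regular zeros. It is enough to differentiate the coordinates of
  -- these tuples by term functions; `TermFun.exists_derivative` can then be iterated.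
  let P : ∀ N : Str L Empty, (N.K → N.K) → (Fin (m + 1) ⊕ W → N.K) → Prop := fun N d a =>
    ∃ x b, IsCompatible s N d b ∧ N.evalPoly (jet d x b) (toJetPoly m p) = 0 ∧
      N.evalPoly (jet d x b) (toJetPoly m p.derivative) ≠ 0 ∧
      a = jet d x b ∘ Sum.map Fin.val id
  have hP : ∀ N d a, P N d a → IsDerivationOn N d := fun N d a ⟨x, b, h, _⟩ => h.derivation
  have hvar : ∀ v, ∃ g, TermFun L (Fin (m + 1) ⊕ W) g ∧
      ∀ N d a, P N d a → d (a v) = g N a := by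
    rintro (i | v)
    · by_cases hi : (i : ℕ) < m
      · refine ⟨_, .var (.inl ⟨i + 1, by omega⟩), ?_⟩
        rintro N d _ ⟨x, b, -, -, -, rfl⟩
        exact (Function.iterate_succ_apply' d i x).symm
      -- The last coordinate `δ^m x`: differentiating the equation gives `0 = S * δ^(m+1) x + G`
      -- with `S` the separant, which is solved for `δ^(m+1) x`.
      · obtain ⟨G, hG, h⟩ := exists_derivative_toJetPoly s p
        obtain ⟨G', rfl⟩ := exists_rename_eq hG
        obtain ⟨S, hS⟩ := exists_rename_eq (toJetPoly_mem m p.derivative)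
        refine ⟨_, ((termFun_evalPoly G').mul (termFun_evalPoly S).inv).neg, ?_⟩
        rintro N d _ ⟨x, b, hb, h0, hs, rfl⟩
        have hi : (i : ℕ) = m := by omega
        have := h N d x b hb
        rw [h0, hb.derivation.zero] at this
        rw [← hS] at this hs
        rw [N.evalPoly_rename] at this hs
        rw [N.evalPoly_rename] at this
        change d (d^[i] x) = _
        rw [hi, ← Function.iterate_succ_apply' d m x]
        field_simp
        linear_combination -this
    · refine ⟨_, .var (.inr (s v)), ?_⟩
      rintro N d _ ⟨x, b, hb, -, -, rfl⟩
      exact hb.param v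
  suffices h : ∃ f, TermFun L (Fin (m + 1) ⊕ W) f ∧ ∀ (N : Str L Empty) (d : N.K → N.K) a,
      P N d a → d^[j] (a (.inl 0)) = f N a by
    obtain ⟨f, hf, h⟩ := h
    exact ⟨f, hf, fun N d x b hb h0 hs => h N d _ ⟨x, b, hb, h0, hs, rfl⟩⟩
  induction j with
  | zero => exact ⟨_, .var (.inl 0), fun _ _ _ _ => rfl⟩
  | succ j ih =>
    obtain ⟨f, hf, h⟩ := ih
    obtain ⟨g, hg, h'⟩ := hf.exists_derivative hP hvar
    refine ⟨g, hg, fun N d a ha => ?_⟩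
    rw [Function.iterate_succ_apply', h N d a ha, h' N d a ha]

/-! ### Specialization of the parameters -/

/-- The differential polynomial obtained by substituting values for the parameters. -/
noncomputable def specialize (N : Str L Empty) (b : W → N.K) : JetPoly L W →+* MvPolynomial ℕ N.K :=
  MvPolynomial.eval₂Hom (MvPolynomial.C.comp N.coeffHom)
    (Sum.elim MvPolynomial.X (fun v => MvPolynomial.C (b v)))

theorem eval_specialize (N : Str L Empty) (b : W → N.K) (u : ℕ → N.K) (q : JetPoly L W) :
    MvPolynomial.eval u (specialize N b q) = N.evalPoly (Sum.elim u b) q := by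
  induction q using MvPolynomial.induction_on with
  | C c => simp [specialize, Str.evalPoly_C]
  | add p q hp hq => rw [map_add, map_add, map_add, hp, hq]
  | mul_X p v hp =>
    rw [map_mul, map_mul, map_mul, hp, Str.evalPoly_X]
    rcases v with j | v <;> simp [specialize]

theorem specialize_mem_supported (N : Str L Empty) (b : W → N.K) {m : ℕ} {q : JetPoly L W}
    (hq : q ∈ orderLT L W m) : specialize N b q ∈ MvPolynomial.supported N.K {j | j < m} := by
  induction hq using orderLT_induction with
  | inl j hj =>
    have : specialize N b (.X (.inl j)) = .X j := by simp [specialize]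
    rw [this]
    exact Algebra.subset_adjoin ⟨j, hj, rfl⟩
  | inr v =>
    have : specialize N b (.X (.inr v)) = .C (b v) := by simp [specialize]
    rw [this]
    exact Subalgebra.algebraMap_mem _ (b v)
  | C c =>
    have : specialize N b (.C c) = .C (N.coeffHom c) := by simp [specialize]
    rw [this]
    exact Subalgebra.algebraMap_mem _ (N.coeffHom c)
  | add q r _ _ hq hr =>
    rw [map_add]
    exact add_mem hq hr
  | mul q r _ _ hq hr =>
    rw [map_mul]
    exact mul_mem hq hr

/-- The coefficients have order less than `m` and so do not contribute. This identifies the separant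
in (DL) with the formal derivative in `δ^m x`. -/
theorem pderiv_specialize (N : Str L Empty) (b : W → N.K) {m : ℕ}
    (p : Polynomial (orderLT L W m)) :
    MvPolynomial.pderiv m (specialize N b (toJetPoly m p)) =
      specialize N b (toJetPoly m p.derivative) := by
  have hX : specialize N b (.X (.inl m)) = .X m := by simp [specialize]
  induction p using Polynomial.induction_on' with
  | add p q hp hq => simp only [map_add, hp, hq]
  | monomial n a =>
    induction n with
    | zero =>
      rw [Polynomial.monomial_zero_left, toJetPoly_C, Polynomial.derivative_C, map_zero, map_zero]
      refine MvPolynomial.pderiv_eq_zero_of_notMem_vars fun h => ?_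
      have := MvPolynomial.mem_supported.1 (specialize_mem_supported N b a.2) h
      exact lt_irrefl m this
    | succ n ih =>
      rw [← Polynomial.monomial_mul_X, Polynomial.derivative_mul, map_mul, map_mul,
        MvPolynomial.pderiv_mul, ih, toJetPoly_X, hX, MvPolynomial.pderiv_X_self,
        Polynomial.derivative_X, mul_one, mul_one, map_add, map_add, map_mul, map_mul,
        toJetPoly_X, hX]

end GenericDerivation

/-! ### Elimination of one differential variable under (DL). -/

namespace GenericDerivation

variable {L : FieldLanguage.{u}} {W : Type} {T : Theory L Empty} {p l : ℕ} {Δ : Fin l → L.Aux}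
  {χ : Formula L Empty (p + 1) Δ} {k : ℕ} {E : Fin k → L.Aux} {s : W → W}

/-! ### Transfer from the structure defining the theory -/

theorem IsTheoryOfTopologicalFields.satisfies_iff (hT : IsTheoryOfTopologicalFields T χ) :
    ∃ K₀ : Str L Empty, CharZero K₀.K ∧ DefinesFieldTopology K₀ χ ∧
      ∀ N : Str L Empty, N.Models T → ∀ φ : Sentence L Empty, N.Satisfies φ ↔ K₀.Satisfies φ := by
  obtain ⟨K₀, h0, htop, rfl⟩ := hT
  refine ⟨K₀, h0, htop, fun N hN φ => ⟨fun h => ?_, fun h => hN φ h⟩⟩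
  by_contra hφ
  exact hN (.imp φ .falsum) hφ h

/-- Each equation `n = 0` is a sentence, so it has the same truth value in `N` as in `K₀`. -/
theorem IsTheoryOfTopologicalFields.charZero (hT : IsTheoryOfTopologicalFields T χ)
    {N : Str L Empty} (hN : N.Models T) : CharZero N.K := by
  obtain ⟨K₀, h0, -, h⟩ := hT.satisfies_iff
  refine charZero_of_inj_zero fun n hn => ?_
  obtain ⟨m, e, t, ht⟩ := (termFun_natCast (L := L) Empty n).exists_term
  obtain rfl : m = 0 := by
    rcases m with _ | m
    · rfl
    · exact (e 0).elim
  have key : ∀ N' : Str L Empty, t.eval N' Fin.elim0 = n := fun N' => by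
    rw [ht N' (fun v => v.elim)]
    congr 1
    exact Subsingleton.elim _ _
  have := (h N hN (.eqField t .zero)).1 ((key N).trans hn)
  have h' : t.eval K₀ Fin.elim0 = 0 := this
  rw [key] at h'
  exact_mod_cast h'

/-- That `χ(0, z)` holds for all `z` is a sentence, true in `K₀` because the basic sets there are
neighbourhoods of `0`. -/
theorem IsTheoryOfTopologicalFields.zero_mem_basicSet (hT : IsTheoryOfTopologicalFields T χ)
    {N : Str L Empty} (hN : N.Models T) (z) : (0 : N.K) ∈ basicSet N χ z := by
  obtain ⟨K₀, -, ⟨top, -, -, -, hbasis⟩, h⟩ := hT.satisfies_iff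
  obtain ⟨ψ, hψ⟩ := exists_closure (χ.subst (Fin.cons .zero .var : Fin (p + 1) → _))
  have key : ∀ (N' : Str L Empty) x w, (χ.subst (Fin.cons .zero .var : Fin (p + 1) → _)).Realize
      N' x w ↔ (0 : N'.K) ∈ basicSet N' χ (x, w) := by
    intro N' x w
    rw [Formula.realize_subst]
    have : (fun i => ((Fin.cons .zero .var : Fin (p + 1) → FieldTerm L Empty p) i).eval N' x) =
        (Fin.cons 0 x : Fin (p + 1) → N'.K) := by
      funext i
      exact Fin.cases rfl (fun _ => rfl) i
    rw [this]
    rfl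
  refine (key N z.1 z.2).1 ((hψ N).1 ((h N hN ψ).2 ((hψ K₀).2 fun x w => ?_)) z.1 z.2)
  exact (key K₀ x w).2 (mem_of_mem_nhds (hbasis.mem_of_mem (i := (x, w)) trivial))

/-! ### Generic derivations -/

/-- `d` is a derivation on the model `N` of `T` satisfying the scheme (DL). -/
structure IsGeneric (T : Theory L Empty) (χ : Formula L Empty (p + 1) Δ) (N : Str L Empty)
    (d : N.K → N.K) : Prop where
  models : N.Models T
  derivation : IsDerivationOn N d
  dl : ∀ (m : ℕ) (P : MvPolynomial ℕ N.K), 1 ≤ m → m ∈ P.vars → (∀ j ∈ P.vars, j ≤ m) →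
    ∀ (z : (Fin p → N.K) × (∀ j, N.aux (Δ j))) (y : ℕ → N.K),
      MvPolynomial.eval y P = 0 → MvPolynomial.eval y (MvPolynomial.pderiv m P) ≠ 0 →
      ∃ b : N.K, MvPolynomial.eval (fun j => d^[j] b) P = 0 ∧
        MvPolynomial.eval (fun j => d^[j] b) (MvPolynomial.pderiv m P) ≠ 0 ∧
        ∀ j ≤ m, d^[j] b - y j ∈ basicSet N χ z

/-- The scheme (DL) for polynomials with parameters, extended to `m = 0`: there the equation
concerns only `x` itself, and `u 0` is a solution. -/
theorem IsGeneric.exists_jet {N : Str L Empty} {d : N.K → N.K} (h : IsGeneric T χ N d)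
    (hT : IsTheoryOfTopologicalFields T χ) {m : ℕ} (P : Polynomial (orderLT L W m))
    (b : W → N.K) (z : (Fin p → N.K) × (∀ j, N.aux (Δ j))) (u : ℕ → N.K)
    (h0 : N.evalPoly (Sum.elim u b) (toJetPoly m P) = 0)
    (hs : N.evalPoly (Sum.elim u b) (toJetPoly m P.derivative) ≠ 0) :
    ∃ x, N.evalPoly (jet d x b) (toJetPoly m P) = 0 ∧
      N.evalPoly (jet d x b) (toJetPoly m P.derivative) ≠ 0 ∧
      ∀ j ≤ m, d^[j] x - u j ∈ basicSet N χ z := by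
  rcases Nat.eq_zero_or_pos m with rfl | hm
  · have key : ∀ Q : Polynomial (orderLT L W 0), N.evalPoly (jet d (u 0) b) (toJetPoly 0 Q) =
        N.evalPoly (Sum.elim u b) (toJetPoly 0 Q) := by
      refine fun Q => evalPoly_congr N (toJetPoly_mem 0 Q) (fun j hj => ?_) fun _ => rfl
      obtain rfl : j = 0 := by omega
      rfl
    refine ⟨u 0, by rwa [key], by rwa [key], fun j hj => ?_⟩
    obtain rfl : j = 0 := by omega
    rw [Function.iterate_zero_apply, sub_self]
    exact hT.zero_mem_basicSet h.models z
  · have hder : MvPolynomial.eval u (MvPolynomial.pderiv m (specialize N b (toJetPoly m P))) ≠ 0 := by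
      rwa [pderiv_specialize, eval_specialize]
    -- The variable `m` occurs in the specialized polynomial because its separant does not vanish.
    obtain ⟨x, hx, hx', hz⟩ := h.dl m (specialize N b (toJetPoly m P)) hm
      (by
        by_contra hv
        rw [MvPolynomial.pderiv_eq_zero_of_notMem_vars hv, map_zero] at hder
        exact hder rfl)
      (fun j hj => Nat.lt_succ_iff.1 (MvPolynomial.mem_supported.1
        (specialize_mem_supported N b (toJetPoly_mem m P)) hj))
      z u (by rwa [eval_specialize]) hder
    rw [eval_specialize] at hx
    rw [pderiv_specialize, eval_specialize] at hx'
    exact ⟨x, hx, hx', hz⟩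

/-! ### Elimination of one differential variable -/

/-- The existence of `x` such that the derivatives of `x` and the parameters satisfy `Φ` is
definable in terms of the parameters, for generic derivations. -/
def Eliminable (T : Theory L Empty) (χ : Formula L Empty (p + 1) Δ) (E : Fin k → L.Aux)
    (s : W → W) (Φ : ∀ N : Str L Empty, (ℕ ⊕ W → N.K) → (∀ j, N.aux (E j)) → Prop) : Prop :=
  ∃ Ψ : ∀ N : Str L Empty, (W → N.K) → (∀ j, N.aux (E j)) → Prop, Definable T E W Ψ ∧
    ∀ (N : Str L Empty) (d : N.K → N.K), IsGeneric T χ N d → ∀ b, IsCompatible s N d b →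
      ∀ w, (∃ x, Φ N (jet d x b) w) ↔ Ψ N b w

namespace Eliminable

variable {Φ Ψ : ∀ N : Str L Empty, (ℕ ⊕ W → N.K) → (∀ j, N.aux (E j)) → Prop}

theorem congr (h : Eliminable T χ E s Φ)
    (hΨ : ∀ (N : Str L Empty) (d : N.K → N.K), IsGeneric T χ N d → ∀ b, IsCompatible s N d b →
      ∀ x w, Ψ N (jet d x b) w ↔ Φ N (jet d x b) w) : Eliminable T χ E s Ψ := by
  obtain ⟨Ξ, hΞ, h⟩ := h
  refine ⟨Ξ, hΞ, fun N d hd b hb w => Iff.trans ?_ (h N d hd b hb w)⟩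
  exact exists_congr fun x => hΨ N d hd b hb x w

theorem false : Eliminable T χ E s (fun _ _ _ => False) :=
  ⟨_, .false, fun N d _ b _ w => by simp⟩

theorem or (h₁ : Eliminable T χ E s Φ) (h₂ : Eliminable T χ E s Ψ) :
    Eliminable T χ E s (fun N a w => Φ N a w ∨ Ψ N a w) := by
  obtain ⟨Ξ₁, hΞ₁, h₁⟩ := h₁
  obtain ⟨Ξ₂, hΞ₂, h₂⟩ := h₂
  refine ⟨_, hΞ₁.or hΞ₂, fun N d hd b hb w => ?_⟩
  rw [← h₁ N d hd b hb w, ← h₂ N d hd b hb w, exists_or]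

theorem exists_list {ι : Type*}
    {Φ : ι → ∀ N : Str L Empty, (ℕ ⊕ W → N.K) → (∀ j, N.aux (E j)) → Prop} (S : List ι)
    (h : ∀ i ∈ S, Eliminable T χ E s (Φ i)) :
    Eliminable T χ E s (fun N a w => ∃ i ∈ S, Φ i N a w) := by
  induction S with
  | nil => exact false.congr fun _ _ _ _ _ _ _ => by simp
  | cons i S ih =>
    exact ((h i (by simp)).or (ih fun j hj => h j (by simp [hj]))).congr
      fun _ _ _ _ _ _ _ => by simp

theorem exists_lt {Φ : ℕ → ∀ N : Str L Empty, (ℕ ⊕ W → N.K) → (∀ j, N.aux (E j)) → Prop} (n : ℕ)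
    (h : ∀ i < n, Eliminable T χ E s (Φ i)) :
    Eliminable T χ E s (fun N a w => ∃ i < n, Φ i N a w) :=
  (exists_list (List.range n) fun i hi => h i (List.mem_range.1 hi)).congr
    fun _ _ _ _ _ _ _ => by simp

end Eliminable

/-- Equations of order less than `m` which are non-trivial for the given values of the parameters
can be eliminated. -/
def EliminatesOrderLT (T : Theory L Empty) (χ : Formula L Empty (p + 1) Δ) (E : Fin k → L.Aux)
    (s : W → W) (m : ℕ) : Prop :=
  ∀ q ∈ orderLT L W m, ∀ Φ : ∀ N : Str L Empty, (ℕ ⊕ W → N.K) → (∀ j, N.aux (E j)) → Prop,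
    Definable T E (ℕ ⊕ W) Φ → Eliminable T χ E s (fun N a w => N.evalPoly a q = 0 ∧
      (∃ u : ℕ → N.K, N.evalPoly (Sum.elim u (a ∘ Sum.inr)) q ≠ 0) ∧ Φ N a w)

/-- Equations of order `m` and of degree `d` in the derivative of order `m` can be eliminated, the
leading coefficient being non-zero. -/
def EliminatesDegree (T : Theory L Empty) (χ : Formula L Empty (p + 1) Δ) (E : Fin k → L.Aux)
    (s : W → W) (m d : ℕ) : Prop :=
  ∀ P : Polynomial (orderLT L W m), P.natDegree ≤ d →
    ∀ Φ : ∀ N : Str L Empty, (ℕ ⊕ W → N.K) → (∀ j, N.aux (E j)) → Prop,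
    Definable T E (ℕ ⊕ W) Φ → Eliminable T χ E s (fun N a w => N.evalPoly a (toJetPoly m P) = 0 ∧
      N.evalPoly a (P.coeff d : JetPoly L W) ≠ 0 ∧ Φ N a w)

/-- Non-triviality of an equation for the given parameters is an `L`-condition on them, so the
elimination may distinguish cases according to it. -/
theorem definable_exists_evalPoly_ne_zero (q : JetPoly L W) :
    Definable T E W (fun N b _ => ∃ u : ℕ → N.K, N.evalPoly (Sum.elim u b) q ≠ 0) :=
  (Definable.evalPoly_eq_zero q).not.exists_sum

/-- A predicate which is open, for the topology defined by `χ`, in all models of `T`. -/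
def IsOpenPredicate (T : Theory L Empty) (χ : Formula L Empty (p + 1) Δ) {V : Type}
    (Θ : ∀ N : Str L Empty, (V → N.K) → (∀ j, N.aux (E j)) → Prop) : Prop :=
  ∀ N : Str L Empty, N.Models T → ∀ a w, Θ N a w →
    ∃ z, ∀ a' : V → N.K, (∀ v, a' v - a v ∈ basicSet N χ z) → Θ N a' w

theorem Definable.exists_order_bound
    {Φ : ∀ N : Str L Empty, (ℕ ⊕ W → N.K) → (∀ j, N.aux (E j)) → Prop}
    (hΦ : Definable T E (ℕ ⊕ W) Φ) :
    ∃ (m : ℕ) (Φ' : ∀ N : Str L Empty, (Fin m ⊕ W → N.K) → (∀ j, N.aux (E j)) → Prop),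
      Definable T E (Fin m ⊕ W) Φ' ∧ ∀ N : Str L Empty, N.Models T → ∀ a w,
        Φ N a w ↔ Φ' N (a ∘ Sum.map Fin.val id) w := by
  obtain ⟨n, e, φ, h⟩ := hΦ
  obtain ⟨m, hm⟩ : ∃ m, ∀ i j, e i = .inl j → j < m := by
    refine ⟨Finset.univ.sup (fun i => (e i).elim (fun j => j + 1) fun _ => 0), fun i j hj => ?_⟩
    have := Finset.le_sup (f := fun i => (e i).elim (fun j => j + 1) fun _ => 0)
      (Finset.mem_univ i)
    simp only [hj, Sum.elim_inl] at this
    exact this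
  have he : ∀ i, ∃ v : Fin m ⊕ W, Sum.map Fin.val id v = e i := by
    intro i
    rcases hv : e i with j | v
    · exact ⟨.inl ⟨j, hm i j hv⟩, rfl⟩
    · exact ⟨.inr v, rfl⟩
  choose e' he' using he
  obtain rfl : Sum.map Fin.val id ∘ e' = e := funext he'
  exact ⟨m, _, ⟨n, e', φ, fun _ _ _ _ => Iff.rfl⟩, fun N hN a w => h N hN a w⟩

section

variable (hT : IsOpenTheory T χ)
include hT

/-- An arbitrary tuple `u` satisfying the algebraic conditions can be replaced, by (DL), by a jet so
close to it that the open condition `Θ` persists. The eliminated condition is the existence of such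
a `u`. -/
theorem eliminable_regular {m : ℕ} (P : Polynomial (orderLT L W m))
    {Ξ : ∀ N : Str L Empty, (W → N.K) → (∀ j, N.aux (E j)) → Prop} (hΞ : Definable T E W Ξ)
    {Θ : ∀ N : Str L Empty, (Fin (m + 1) ⊕ W → N.K) → (∀ j, N.aux (E j)) → Prop}
    (hΘ : Definable T E (Fin (m + 1) ⊕ W) Θ) (hopen : IsOpenPredicate T χ Θ) :
    Eliminable T χ E s (fun N a w => N.evalPoly a (toJetPoly m P) = 0 ∧
      N.evalPoly a (toJetPoly m P.derivative) ≠ 0 ∧ Ξ N (a ∘ Sum.inr) w ∧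
      Θ N (a ∘ Sum.map Fin.val id) w) := by
  refine ⟨_, hΞ.and ((Definable.evalPoly_eq_zero (toJetPoly m P)).and
    ((Definable.evalPoly_eq_zero (toJetPoly m P.derivative)).not.and
      (hΘ.comp_map (Sum.map Fin.val id)))).exists_sum, fun N d hd b hb w => ⟨?_, ?_⟩⟩
  · rintro ⟨x, h0, hs, h, hx⟩
    exact ⟨h, fun j => d^[j] x, h0, hs, hx⟩
  · rintro ⟨h, u, h0, hs, hu⟩
    obtain ⟨z, hz⟩ := hopen N hd.models _ w hu
    obtain ⟨x, hx0, hxs, hx⟩ := hd.exists_jet hT.topological P b z u h0 hs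
    refine ⟨x, hx0, hxs, h, hz _ fun v => ?_⟩
    rcases v with j | v
    · exact hx j (Nat.lt_succ_iff.1 j.2)
    · change b v - b v ∈ _
      rw [sub_self]
      exact hT.topological.zero_mem_basicSet hd.models z

/-- The equations in `R` either give an equation of smaller degree or order, to which the inductive
hypotheses apply, or can be dropped. -/
theorem eliminable_of_natDegree_lt {m n : ℕ} (hm : EliminatesOrderLT T χ E s m)
    (hn : ∀ i < n, EliminatesDegree T χ E s m i) (P : Polynomial (orderLT L W m))
    (R : List (Polynomial (orderLT L W m))) (hR : ∀ r ∈ R, r.natDegree < n)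
    {Θ : ∀ N : Str L Empty, (Fin (m + 1) ⊕ W → N.K) → (∀ j, N.aux (E j)) → Prop}
    (hΘ : Definable T E (Fin (m + 1) ⊕ W) Θ) (hopen : IsOpenPredicate T χ Θ) :
    Eliminable T χ E s (fun N a w => N.evalPoly a (toJetPoly m P) = 0 ∧
      N.evalPoly a (toJetPoly m P.derivative) ≠ 0 ∧
      (∀ r ∈ R, N.evalPoly a (toJetPoly m r) = 0) ∧ Θ N (a ∘ Sum.map Fin.val id) w) := by
  set Φ : ∀ N : Str L Empty, (ℕ ⊕ W → N.K) → (∀ j, N.aux (E j)) → Prop :=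
    fun N a w => N.evalPoly a (toJetPoly m P) = 0 ∧
      N.evalPoly a (toJetPoly m P.derivative) ≠ 0 ∧
      (∀ r ∈ R, N.evalPoly a (toJetPoly m r) = 0) ∧ Θ N (a ∘ Sum.map Fin.val id) w
  have hΦ : Definable T E (ℕ ⊕ W) Φ := (Definable.evalPoly_eq_zero _).and
    ((Definable.evalPoly_eq_zero _).not.and ((Definable.forall_list R fun r _ =>
      Definable.evalPoly_eq_zero _).and (hΘ.comp_map _)))
  -- Some coefficient of some `r` is non-zero at the jet: a truncation of `r` is an equation of
  -- degree `i < n` with non-zero leading coefficient.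
  have h₁ := Eliminable.exists_list R fun r _ => Eliminable.exists_lt n fun i hi =>
    hn i hi (truncate r i) (natDegree_truncate_le r i) Φ hΦ
  -- All coefficients vanish at the jet, but one of them is non-trivial for the given parameters:
  -- this is an equation of order less than `m`.
  have h₂ := Eliminable.exists_list R fun r _ => Eliminable.exists_lt n fun i _ =>
    hm (r.coeff i) (r.coeff i).2 Φ hΦ
  -- All coefficients vanish identically for the given parameters: the equations in `R` hold
  -- automatically.
  have hΞ : Definable T E W (fun N b _ => ∀ r ∈ R, ∀ i ∈ List.range n,
      ¬ ∃ u : ℕ → N.K, N.evalPoly (Sum.elim u b) (r.coeff i : JetPoly L W) ≠ 0) :=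
    Definable.forall_list R fun r _ => Definable.forall_list (List.range n) fun i _ =>
      (definable_exists_evalPoly_ne_zero _).not
  have h₃ := eliminable_regular (s := s) hT P hΞ hΘ hopen
  refine (h₁.or (h₂.or h₃)).congr fun N d hd b hb x w => ⟨fun h => ?_, ?_⟩
  · by_cases hc : ∃ r ∈ R, ∃ i < n, N.evalPoly (jet d x b) (r.coeff i : JetPoly L W) ≠ 0
    · obtain ⟨r, hr, hi⟩ := hc
      obtain ⟨i, hi, hne, heq⟩ := exists_evalPoly_truncate_eq N _ (hR r hr) hi
      exact Or.inl ⟨r, hr, i, hi, heq.trans (h.2.2.1 r hr), hne, h⟩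
    · push Not at hc
      refine Or.inr ?_
      by_cases hc' : ∃ r ∈ R, ∃ i < n,
          ∃ u : ℕ → N.K, N.evalPoly (Sum.elim u b) (r.coeff i : JetPoly L W) ≠ 0
      · obtain ⟨r, hr, i, hi, hu⟩ := hc'
        exact Or.inl ⟨r, hr, i, hi, hc r hr i hi, hu, h⟩
      · refine Or.inr ⟨h.1, h.2.1, fun r hr i hi hu => ?_, h.2.2.2⟩
        exact hc' ⟨r, hr, i, List.mem_range.1 hi, hu⟩
  · rintro (⟨r, hr, i, hi, -, -, h⟩ | ⟨r, hr, i, hi, -, -, h⟩ | ⟨h0, hs, hΞ, hx⟩)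
    · exact h
    · exact h
    · refine ⟨h0, hs, fun r hr => ?_, hx⟩
      rw [evalPoly_toJetPoly N _ (hR r hr)]
      refine Finset.sum_eq_zero fun i hi => ?_
      have : N.evalPoly (jet d x b) (r.coeff i : JetPoly L W) = 0 := by
        by_contra hne
        exact hΞ r hr i (by simpa using hi) ⟨_, hne⟩
      rw [this, zero_mul]

/-- At a regular zero of `P`, the condition `Φ` on the full jet becomes one on `x, …, δ^m x`. The
equations of its open normal form may be replaced by their pseudo-remainders modulo `P`, of degree
less than `n`. -/
theorem eliminable_separant_ne_zero {m n : ℕ} (hm : EliminatesOrderLT T χ E s m)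
    (hn : ∀ i < n, EliminatesDegree T χ E s m i) (hn0 : 0 < n) (P : Polynomial (orderLT L W m))
    (hP : P.natDegree ≤ n)
    {Φ : ∀ N : Str L Empty, (ℕ ⊕ W → N.K) → (∀ j, N.aux (E j)) → Prop}
    (hΦ : Definable T E (ℕ ⊕ W) Φ) :
    Eliminable T χ E s (fun N a w => N.evalPoly a (toJetPoly m P) = 0 ∧
      N.evalPoly a (P.coeff n : JetPoly L W) ≠ 0 ∧
      N.evalPoly a (toJetPoly m P.derivative) ≠ 0 ∧ Φ N a w) := by
  choose f hf hfx using exists_termFun_iterate s P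
  obtain ⟨r, Q, Θ, hΘ, hΦΘ⟩ := (hΦ.comp (V' := Fin (m + 1) ⊕ W)
    (g := fun v => v.elim f fun v N a => a (.inr v))
    (by rintro (j | v); exacts [hf j, .var _])).exists_open_form hT
  choose pre hpre using fun q : MvPolynomial (Fin (m + 1) ⊕ W) (MvPolynomial L.Const ℤ) =>
    exists_toJetPoly_eq (rename_mem_orderLT q)
  choose e q₁ q₂ hq hdeg using
    exists_pseudo_division (R := orderLT L W m) P hn0 hP
  -- Multiplying `P` by its leading coefficient makes the non-vanishing of the separant express both
  -- inequations at once.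
  have h := Eliminable.exists_list (List.finRange r) fun i _ =>
    eliminable_of_natDegree_lt hT hm hn (.C (P.coeff n) * P) ((Q i).map fun q => q₂ (pre q))
      (by simp [hdeg]) (hΘ i).1 (hΘ i).2
  refine h.congr fun N d hd b hb x w => ?_
  set a := jet d x b
  simp only [List.mem_finRange, true_and, Polynomial.derivative_C_mul, map_mul, toJetPoly_C,
    List.forall_mem_map]
  have key : N.evalPoly a (toJetPoly m P) = 0 → N.evalPoly a (P.coeff n : JetPoly L W) ≠ 0 →
      N.evalPoly a (toJetPoly m P.derivative) ≠ 0 → (Φ N a w ↔ ∃ i,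
        (∀ q ∈ Q i, N.evalPoly a (toJetPoly m (q₂ (pre q))) = 0) ∧
          Θ i N (a ∘ Sum.map Fin.val id) w) := by
    intro h0 hc hs
    have ha' : a = fun v => (v.elim f fun v N a => a (.inr v) :
        ∀ N : Str L Empty, (Fin (m + 1) ⊕ W → N.K) → N.K) N (a ∘ Sum.map Fin.val id) := by
      funext v
      rcases v with j | v
      · exact hfx j N d x b hb h0 hs
      · rfl
    have h1 := hΦΘ N hd.models (a ∘ Sum.map Fin.val id) w
    rw [← ha'] at h1
    refine h1.trans (exists_congr fun i => and_congr_left' (forall₂_congr fun q _ => ?_))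
    rw [← N.evalPoly_rename, ← hpre q]
    -- At a zero of `P` with non-zero leading coefficient, a polynomial vanishes if and only if its
    -- pseudo-remainder does.
    have h2 := congrArg (fun R => N.evalPoly a (toJetPoly m R)) (hq (pre q))
    simp only [map_mul, map_pow, map_add, toJetPoly_C, h0, mul_zero, zero_add] at h2
    rw [← h2]
    simp [hc]
  constructor
  · rintro ⟨h0, hc, hs, h⟩
    obtain ⟨i, hi, hΘi⟩ := (key h0 hc hs).1 h
    exact ⟨i, by rw [h0, mul_zero], mul_ne_zero hc hs, hi, hΘi⟩
  · rintro ⟨i, h0, hs, hi, hΘi⟩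
    have hc := left_ne_zero_of_mul hs
    have h0' := (mul_eq_zero.1 h0).resolve_left hc
    exact ⟨h0', hc, right_ne_zero_of_mul hs,
      (key h0' hc (right_ne_zero_of_mul hs)).2 ⟨i, hi, hΘi⟩⟩

/-- If the separant vanishes, it is an equation of degree one less, whose leading coefficient is
non-zero because the characteristic is `0`. If not, `eliminable_separant_ne_zero` applies. -/
theorem eliminatesDegree {m : ℕ} (hm : EliminatesOrderLT T χ E s m) (n : ℕ) :
    EliminatesDegree T χ E s m n := by
  induction n using Nat.strong_induction_on with
  | _ n ih =>
    intro P hP Φ hΦ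
    rcases n with _ | n
    · refine Eliminable.false.congr fun N d hd b hb x w => iff_false_intro ?_
      rintro ⟨h0, hc, -⟩
      rw [Polynomial.eq_C_of_natDegree_le_zero hP, toJetPoly_C] at h0
      exact hc h0
    · have h₁ := ih n (Nat.lt_succ_self n) P.derivative
        ((Polynomial.natDegree_derivative_le P).trans (by omega)) _
        (hΦ.and ((Definable.evalPoly_eq_zero (toJetPoly m P)).and
          (Definable.evalPoly_eq_zero (P.coeff (n + 1) : JetPoly L W)).not))
      have h₂ := eliminable_separant_ne_zero hT hm ih (Nat.succ_pos n) P hP hΦ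
      refine (h₁.or h₂).congr fun N d hd b hb x w => ?_
      have := hT.topological.charZero hd.models
      have hc : N.evalPoly (jet d x b) (P.derivative.coeff n : JetPoly L W) =
          N.evalPoly (jet d x b) (P.coeff (n + 1) : JetPoly L W) * (n + 1) := by
        rw [Polynomial.coeff_derivative]
        simp
      have hn : (n + 1 : N.K) ≠ 0 := by exact_mod_cast Nat.succ_ne_zero n
      rw [hc, mul_ne_zero_iff]
      tauto

/-- Either some coefficient in `δ^m x` is non-zero at the jet, and a truncation reduces to
`eliminatesDegree`, or all vanish there and one of them is a non-trivial equation of smaller order.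
-/
theorem eliminatesOrderLT (m : ℕ) : EliminatesOrderLT T χ E s m := by
  induction m with
  | zero =>
    intro q hq Φ hΦ
    -- A polynomial of order less than `0` involves parameters only, so it cannot vanish at the jet
    -- and be non-zero at another `u`.
    refine Eliminable.false.congr fun N d hd b hb x w => iff_false_intro ?_
    rintro ⟨h0, ⟨u, hu⟩, -⟩
    rw [evalPoly_congr N hq (fun j hj => absurd hj (Nat.not_lt_zero j)) (fun v => ?_)] at hu
    exacts [hu h0, rfl]
  | succ m ih =>
    intro q hq Φ hΦ
    obtain ⟨P, rfl⟩ := exists_toJetPoly_eq hq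
    have hΦ' := (Definable.evalPoly_eq_zero (toJetPoly m P)).and
      (((definable_exists_evalPoly_ne_zero (toJetPoly m P)).comp_map Sum.inr).and hΦ)
    have h₁ := Eliminable.exists_lt (P.natDegree + 1) fun i _ =>
      eliminatesDegree hT ih i (truncate P i) (natDegree_truncate_le P i) _ hΦ'
    have h₂ := Eliminable.exists_lt (P.natDegree + 1) fun i _ =>
      ih (P.coeff i) (P.coeff i).2 _ hΦ'
    refine (h₁.or h₂).congr fun N d hd b hb x w => ⟨fun h => ?_, ?_⟩
    · by_cases hc : ∃ i < P.natDegree + 1,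
          N.evalPoly (jet d x b) (P.coeff i : JetPoly L W) ≠ 0
      · obtain ⟨i, hi, hne, heq⟩ := exists_evalPoly_truncate_eq N _ (Nat.lt_succ_self _) hc
        exact Or.inl ⟨i, hi, heq.trans h.1, hne, h⟩
      · push Not at hc
        obtain ⟨u, hu⟩ := h.2.1
        rw [evalPoly_toJetPoly N _ (Nat.lt_succ_self _)] at hu
        obtain ⟨i, hi, hne⟩ := Finset.exists_ne_zero_of_sum_ne_zero hu
        have hi' := Finset.mem_range.1 hi
        exact Or.inr ⟨i, hi', hc i hi', ⟨u, left_ne_zero_of_mul hne⟩, h⟩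
    · rintro (⟨i, -, -, -, h⟩ | ⟨i, -, -, -, h⟩) <;> exact h

/-- Definable predicates of the derivatives of one element can be eliminated. -/
theorem Definable.eliminable
    {Φ : ∀ N : Str L Empty, (ℕ ⊕ W → N.K) → (∀ j, N.aux (E j)) → Prop}
    (hΦ : Definable T E (ℕ ⊕ W) Φ) : Eliminable T χ E s Φ := by
  obtain ⟨m, Φ', hΦ', hΦΦ'⟩ := hΦ.exists_order_bound
  obtain ⟨r, Q, Θ, hΘ, hΦΘ⟩ := hΦ'.exists_open_form hT
  let ι : Fin m ⊕ W → ℕ ⊕ W := Sum.map Fin.val id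
  have h₁ := Eliminable.exists_list (List.finRange r) fun i _ =>
    Eliminable.exists_list (Q i) fun q _ =>
      eliminatesOrderLT hT (s := s) m (MvPolynomial.rename ι q) (rename_mem_orderLT q) Φ hΦ
  -- The case in which all equations are trivial for the given parameters, so that only the open
  -- condition remains.
  have h₂ : Eliminable T χ E s (fun N a w => ∃ i ∈ List.finRange r,
      (∀ q ∈ Q i, ¬ ∃ u : ℕ → N.K,
        N.evalPoly (Sum.elim u (a ∘ Sum.inr)) (MvPolynomial.rename ι q) ≠ 0) ∧
      Θ i N (a ∘ ι) w) := by
    refine Eliminable.exists_list _ fun i _ => ?_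
    have hΞ : Definable T E W (fun N b _ => ∀ q ∈ Q i, ¬ ∃ u : ℕ → N.K,
        N.evalPoly (Sum.elim u b) (MvPolynomial.rename ι q) ≠ 0) :=
      Definable.forall_list _ fun q _ => (definable_exists_evalPoly_ne_zero _).not
    refine ⟨_, hΞ.and ((hΘ i).1.comp_map ι).exists_sum, fun N d hd b hb w => ⟨?_, ?_⟩⟩
    · rintro ⟨x, h, hx⟩
      exact ⟨h, fun j => d^[j] x, hx⟩
    · rintro ⟨h, u, hu⟩
      obtain ⟨z, hz⟩ := (hΘ i).2 N hd.models _ w hu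
      -- (DL) is applied to `δ^m x = 0`, whose separant is `1`. Resetting `u` to `0` at `m` makes it
      -- a solution, and `Θ` only sees the indices below `m`.
      have hX := N.evalPoly_X (Sum.elim (Function.update u m 0) b) (.inl m)
      obtain ⟨x, -, -, hx⟩ := hd.exists_jet hT.topological (m := m) .X b z
        (Function.update u m 0) (by rw [toJetPoly_X, hX]; simp) (by simp)
      refine ⟨x, h, hz _ fun v => ?_⟩
      rcases v with j | v
      · have := hx j j.2.le
        rwa [Function.update_of_ne j.2.ne] at this
      · change b v - b v ∈ _
        rw [sub_self]
        exact hT.topological.zero_mem_basicSet hd.models z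
  refine (h₁.or h₂).congr fun N d hd b hb x w => ⟨fun h => ?_, ?_⟩
  · obtain ⟨i, hi, hx⟩ := (hΦΘ N hd.models _ w).1 ((hΦΦ' N hd.models _ w).1 h)
    by_cases hc : ∃ q ∈ Q i, ∃ u : ℕ → N.K,
        N.evalPoly (Sum.elim u b) (MvPolynomial.rename ι q) ≠ 0
    · obtain ⟨q, hq, hu⟩ := hc
      refine Or.inl ⟨i, List.mem_finRange i, q, hq, ?_, hu, h⟩
      rw [N.evalPoly_rename]
      exact hi q hq
    · exact Or.inr ⟨i, List.mem_finRange i, fun q hq hu => hc ⟨q, hq, hu⟩, hx⟩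
  · rintro (⟨i, -, q, -, -, -, h⟩ | ⟨i, -, h, hx⟩)
    · exact h
    · refine (hΦΦ' N hd.models _ w).2 ((hΦΘ N hd.models _ w).2 ⟨i, fun q hq => ?_, hx⟩)
      by_contra hne
      rw [← N.evalPoly_rename] at hne
      exact h q hq ⟨_, hne⟩

end

end GenericDerivation

/-! ### From formulas with a derivation to definable predicates of jets, and back. -/

namespace GenericDerivation

variable {L : FieldLanguage.{u}} {T : Theory L Empty} {p l : ℕ} {Δ : Fin l → L.Aux}
  {χ : Formula L Empty (p + 1) Δ} {k : ℕ} {E : Fin k → L.Aux} {V : Type}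

theorem AuxTerm.eval_rename (M : Str L Empty) {n n' : ℕ} (ρ : Fin n → Fin n') (x : Fin n' → M.K)
    (w : ∀ j, M.aux (E j)) {a : L.Aux} (t : AuxTerm L Empty n E a) :
    (t.subst fun i => (.var (ρ i) : FieldTerm L Empty n')).eval M x w = t.eval M (x ∘ ρ) w := by
  have h := t.eval_subst M (fun i => .var (ρ i)) x w
  obtain ⟨K, aux, const, func, rel, op⟩ := M
  obtain rfl : op = fun d => d.elim := funext fun d => d.elim
  exact h

theorem Definable.forall_aux {c : L.Aux}
    {Φ : ∀ N : Str L Empty, (V → N.K) →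
      (∀ j, N.aux ((Fin.cons c E : Fin (k + 1) → L.Aux) j)) → Prop}
    (h : Definable T (Fin.cons c E : Fin (k + 1) → L.Aux) V Φ) :
    Definable T E V (fun N a w => ∀ b : N.aux c, Φ N a
      (Fin.cons (α := fun j => N.aux ((Fin.cons c E : Fin (k + 1) → L.Aux) j)) b w)) := by
  obtain ⟨n, e, φ, h⟩ := h
  exact ⟨n, e, .allAux c φ, fun N hN a w => forall_congr' fun b => h N hN a _⟩

/-! ### Formulas of the language with a derivation -/

/-- All derivatives of a tuple of field elements. -/
def jets (M : Str L Unit) {n : ℕ} (x : Fin n → M.K) : Fin n × ℕ → M.reduct.K :=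
  fun v => M.der^[v.2] (x v.1)

theorem IsDifferentialModel.isDerivationOn {M : Str L Unit} (h : IsDifferentialModel T M) :
    IsDerivationOn M.reduct M.der :=
  ⟨h.2.1, h.2.2.1, h.2.2.2⟩

theorem IsDifferentialModel.isGeneric {M : Str L Unit} (h : IsDifferentialModel T M)
    (hdl : SatisfiesDL M χ) : IsGeneric T χ M.reduct M.der :=
  ⟨h.1, h.isDerivationOn, hdl⟩

theorem der_jets (M : Str L Unit) {n : ℕ} (x : Fin n → M.K) (v : Fin n × ℕ) :
    M.der (jets M x v) = jets M x (v.1, v.2 + 1) :=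
  (Function.iterate_succ_apply' M.der v.2 (x v.1)).symm

/-- Derivatives of terms are computed by the rules of differentiation, so that `δ` is applied only
to variables, where it shifts the jet. -/
theorem FieldTerm.exists_termFun {n : ℕ} (t : FieldTerm L Unit n) :
    ∃ f, TermFun L (Fin n × ℕ) f ∧ ∀ M : Str L Unit, IsDerivationOn M.reduct M.der →
      ∀ x, t.eval M x = f M.reduct (jets M x) := by
  induction t with
  | var i => exact ⟨_, .var (i, 0), fun _ _ _ => rfl⟩
  | const c => exact ⟨_, .const c, fun _ _ _ => rfl⟩
  | zero => exact ⟨_, .zero, fun _ _ _ => rfl⟩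
  | one => exact ⟨_, .one, fun _ _ _ => rfl⟩
  | add s t hs ht =>
    obtain ⟨f, hf, hs⟩ := hs
    obtain ⟨g, hg, ht⟩ := ht
    exact ⟨_, hf.add hg, fun M h x =>
      congrArg₂ (fun a b : M.K => a + b) (hs M h x) (ht M h x)⟩
  | mul s t hs ht =>
    obtain ⟨f, hf, hs⟩ := hs
    obtain ⟨g, hg, ht⟩ := ht
    exact ⟨_, hf.mul hg, fun M h x =>
      congrArg₂ (fun a b : M.K => a * b) (hs M h x) (ht M h x)⟩
  | neg t ht =>
    obtain ⟨g, hg, ht⟩ := ht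
    exact ⟨_, hg.neg, fun M h x => congrArg (fun a : M.K => -a) (ht M h x)⟩
  | inv t ht =>
    obtain ⟨g, hg, ht⟩ := ht
    exact ⟨_, hg.inv, fun M h x => congrArg (fun a : M.K => a⁻¹) (ht M h x)⟩
  | op d t ht =>
    obtain ⟨f, hf, ht⟩ := ht
    obtain ⟨g, hg, h'⟩ := hf.exists_derivative
      (P := fun N d a => IsDerivationOn N d ∧ ∀ v, d (a v) = a (v.1, v.2 + 1))
      (fun _ _ _ h => h.1) (fun v => ⟨_, .var (v.1, v.2 + 1), fun _ _ _ h => h.2 v⟩)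
    exact ⟨g, hg, fun M h x => (congrArg M.der (ht M h x)).trans
      (h' M.reduct M.der (jets M x) ⟨h, der_jets M x⟩)⟩

theorem AuxTerm.exists_term {n : ℕ} {a : L.Aux} (t : AuxTerm L Unit n E a) :
    ∃ (m : ℕ) (e : Fin m → Fin n × ℕ) (t' : AuxTerm L Empty m E a), ∀ M : Str L Unit,
      IsDerivationOn M.reduct M.der → ∀ x w,
        t.eval M x w = t'.eval M.reduct (jets M x ∘ e) w := by
  induction t with
  | var j => exact ⟨0, Fin.elim0, .var j, fun _ _ _ _ => rfl⟩
  | app f s t ht =>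
    choose g hg hs using fun i => (s i).exists_termFun
    obtain ⟨m₁, e₁, s', hs'⟩ := TermFun.exists_terms hg
    choose m₂ e₂ t' ht' using ht
    obtain ⟨m₂, e₂, ρ, hρ⟩ := exists_common_variables m₂ e₂
    obtain ⟨m, e, ρ₁, ρ₂, rfl, rfl⟩ := exists_common_variables₂ e₁ e₂
    refine ⟨m, e, .app f (fun i => (s' i).rename ρ₁)
      (fun j => (t' j).subst fun i => .var (ρ₂ (ρ j i))), fun M h x w => ?_⟩
    refine congrArg₂ (fun u v => M.func f u v) (funext fun i => ?_) (funext fun j => ?_)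
    · rw [hs i M h x, hs', FieldTerm.eval_rename]
      rfl
    · rw [ht' j M h x w, hρ j]
      exact ((t' j).eval_rename M.reduct (ρ₂ ∘ ρ j) (jets M x ∘ e) w).symm

/-- Field sort quantifier-free formulas of the language with a derivation are definable predicates
of the derivatives of the field variables. -/
theorem Formula.FieldQuantifierFree.exists_definable {n : ℕ} {φ : Formula L Unit n E}
    (hφ : φ.FieldQuantifierFree) : ∃ Φ, Definable T E (Fin n × ℕ) Φ ∧ ∀ M : Str L Unit,
      IsDifferentialModel T M → ∀ x w, φ.Realize M x w ↔ Φ M.reduct (jets M x) w := by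
  induction φ with
  | falsum => exact ⟨_, .false, fun _ _ _ _ => Iff.rfl⟩
  | eqField s t =>
    obtain ⟨f, hf, hs⟩ := s.exists_termFun
    obtain ⟨g, hg, ht⟩ := t.exists_termFun
    refine ⟨_, .eq hf hg, fun M h x w => ?_⟩
    rw [Realize, hs M h.isDerivationOn, ht M h.isDerivationOn]
    rfl
  | eqAux s t =>
    obtain ⟨m₁, e₁, s', hs⟩ := s.exists_term
    obtain ⟨m₂, e₂, t', ht⟩ := t.exists_term
    obtain ⟨m, e, ρ₁, ρ₂, rfl, rfl⟩ := exists_common_variables₂ e₁ e₂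
    refine ⟨_, ⟨m, e, .eqAux (s'.subst fun i => .var (ρ₁ i)) (t'.subst fun i => .var (ρ₂ i)),
      fun _ _ _ _ => Iff.rfl⟩, fun M h x w => ?_⟩
    exact Eq.to_iff (congrArg₂ (fun u v => u = v)
      ((hs M h.isDerivationOn x w).trans (s'.eval_rename M.reduct ρ₁ (jets M x ∘ e) w).symm)
      ((ht M h.isDerivationOn x w).trans (t'.eval_rename M.reduct ρ₂ (jets M x ∘ e) w).symm))
  | rel R s t =>
    choose g hg hs using fun i => (s i).exists_termFun
    obtain ⟨m₁, e₁, s', hs'⟩ := TermFun.exists_terms hg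
    choose m₂ e₂ t' ht' using fun j => (t j).exists_term
    obtain ⟨m₂, e₂, ρ, hρ⟩ := exists_common_variables m₂ e₂
    obtain ⟨m, e, ρ₁, ρ₂, rfl, rfl⟩ := exists_common_variables₂ e₁ e₂
    refine ⟨_, ⟨m, e, .rel R (fun i => (s' i).rename ρ₁)
      (fun j => (t' j).subst fun i => .var (ρ₂ (ρ j i))), fun _ _ _ _ => Iff.rfl⟩,
      fun M h x w => ?_⟩
    refine Eq.to_iff (congrArg₂ (fun u v => M.rel R u v) (funext fun i => ?_)
      (funext fun j => ?_))
    · rw [hs i M h.isDerivationOn x, hs', FieldTerm.eval_rename]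
      rfl
    · rw [ht' j M h.isDerivationOn x w, hρ j]
      exact ((t' j).eval_rename M.reduct (ρ₂ ∘ ρ j) (jets M x ∘ e) w).symm
  | imp φ ψ ihφ ihψ =>
    obtain ⟨Φ, hΦ, h₁⟩ := ihφ hφ.1
    obtain ⟨Ψ, hΨ, h₂⟩ := ihψ hφ.2
    exact ⟨_, hΦ.imp hΨ, fun M h x w => imp_congr (h₁ M h x w) (h₂ M h x w)⟩
  | allField => exact hφ.elim
  | allAux c φ ih =>
    obtain ⟨Φ, hΦ, h⟩ := ih hφ
    exact ⟨_, hΦ.forall_aux, fun M hM x w => forall_congr' fun b => h M hM x _⟩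

/-- The term for an iterated derivative of a variable. -/
def FieldTerm.derivativeVar {n : ℕ} (i : Fin n) : ℕ → FieldTerm L Unit n
  | 0 => .var i
  | j + 1 => .op () (derivativeVar i j)

theorem FieldTerm.eval_derivativeVar (M : Str L Unit) {n : ℕ} (x : Fin n → M.K) (i : Fin n)
    (j : ℕ) : (derivativeVar i j).eval M x = M.der^[j] (x i) := by
  induction j with
  | zero => rfl
  | succ j ih => exact (congrArg M.der ih).trans (Function.iterate_succ_apply' _ _ _).symm

/-- The way back: `T` removes the field sort quantifiers of the `L`-formula, and iterated
derivatives of variables, being terms of `L_δ`, are substituted. -/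
theorem Definable.exists_fieldQuantifierFree (hT : T.EliminatesFieldQuantifiers) {n : ℕ}
    {Φ : ∀ N : Str L Empty, (Fin n × ℕ → N.K) → (∀ j, N.aux (E j)) → Prop}
    (h : Definable T E (Fin n × ℕ) Φ) :
    ∃ ψ : Formula L Unit n E, ψ.FieldQuantifierFree ∧ ∀ M : Str L Unit,
      IsDifferentialModel T M → ∀ x w, ψ.Realize M x w ↔ Φ M.reduct (jets M x) w := by
  obtain ⟨m, e, φ, h⟩ := h
  obtain ⟨ψ, hψ, hφψ⟩ := hT m _ E φ
  refine ⟨ψ.subst fun i => .derivativeVar (e i).1 (e i).2, hψ.subst _, fun M hM x w => ?_⟩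
  refine Iff.trans ?_ ((h M.reduct hM.1 (jets M x) w).trans (hφψ M.reduct hM.1 _ w)).symm
  rw [Formula.realize_subst_reduct]
  simp only [FieldTerm.eval_derivativeVar]
  rfl

/-- Elimination of field sort quantifiers in models of the scheme (DL). -/
theorem exists_fieldQuantifierFree_of_satisfiesDL (hT : IsOpenTheory T χ) {n : ℕ}
    (φ : Formula L Unit n E) : ∃ ψ : Formula L Unit n E, ψ.FieldQuantifierFree ∧
      ∀ M : Str L Unit, IsDifferentialModel T M → SatisfiesDL M χ →
        ∀ x w, φ.Realize M x w ↔ ψ.Realize M x w := by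
  induction φ with
  | falsum => exact ⟨.falsum, trivial, fun _ _ _ _ _ => Iff.rfl⟩
  | eqField s t => exact ⟨.eqField s t, trivial, fun _ _ _ _ _ => Iff.rfl⟩
  | eqAux s t => exact ⟨.eqAux s t, trivial, fun _ _ _ _ _ => Iff.rfl⟩
  | rel R s t => exact ⟨.rel R s t, trivial, fun _ _ _ _ _ => Iff.rfl⟩
  | imp φ₁ φ₂ ih₁ ih₂ =>
    obtain ⟨ψ₁, hψ₁, h₁⟩ := ih₁
    obtain ⟨ψ₂, hψ₂, h₂⟩ := ih₂
    exact ⟨.imp ψ₁ ψ₂, ⟨hψ₁, hψ₂⟩, fun M hM hdl x w =>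
      imp_congr (h₁ M hM hdl x w) (h₂ M hM hdl x w)⟩
  | allAux c φ ih =>
    obtain ⟨ψ, hψ, h⟩ := ih
    exact ⟨.allAux c ψ, hψ, fun M hM hdl x w => forall_congr' fun b => h M hM hdl x _⟩
  | @allField n _ _ φ ih =>
    obtain ⟨ψ, hψ, h⟩ := ih
    obtain ⟨Φ, hΦ, hψΦ⟩ := hψ.exists_definable (T := T)
    -- The jet of the bound variable `0` is separated from the jets of the others, which serve as
    -- parameters; `δ` acts on them by the shift `(i, j) ↦ (i, j + 1)`. The universal quantifier is
    -- treated as the negation of an existential one.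
    let ρ : Fin (n + 1) × ℕ → ℕ ⊕ (Fin n × ℕ) := fun v =>
      Fin.cases (Sum.inl v.2) (fun i => Sum.inr (i, v.2)) v.1
    obtain ⟨Ψ, hΨ, hΦΨ⟩ := (hΦ.not.comp_map ρ).eliminable (s := fun v => (v.1, v.2 + 1)) hT
    obtain ⟨θ, hθ, hΨθ⟩ := hΨ.not.exists_fieldQuantifierFree hT.eliminates
    refine ⟨θ, hθ, fun M hM hdl x w => ?_⟩
    rw [hΨθ M hM x w, ← hΦΨ M.reduct M.der (hM.isGeneric hdl) (jets M x)
      ⟨hM.isDerivationOn, der_jets M x⟩ w, not_exists]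
    refine forall_congr' fun b => ?_
    rw [not_not, h M hM hdl, hψΦ M hM]
    have : jets M (Fin.cons b x : Fin (n + 1) → M.K) =
        (jet M.der b (jets M x) : ℕ ⊕ (Fin n × ℕ) → M.reduct.K) ∘ ρ := by
      funext ⟨i, j⟩
      exact Fin.cases rfl (fun _ => rfl) i
    rw [this]

end GenericDerivation

/-! ### The theorem: elimination and completeness. -/

open GenericDerivation in
theorem theorem2p9 (L : GenericDerivation.FieldLanguage.{u})
    (T : GenericDerivation.Theory L Empty)
    (p l : ℕ) (Δ : Fin l → L.Aux) (χ : GenericDerivation.Formula L Empty (p + 1) Δ)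
    (hT : GenericDerivation.IsOpenTheory T χ)
    (hcons : (GenericDerivation.genericTheory T χ).Consistent) :
    (GenericDerivation.genericTheory T χ).EliminatesFieldQuantifiers ∧
      (GenericDerivation.genericTheory T χ).Complete := by
  refine ⟨fun n k E φ => ?_, hcons, fun φ => ?_⟩
  · obtain ⟨ψ, hψ, h⟩ := exists_fieldQuantifierFree_of_satisfiesDL hT φ
    -- `genericTheory` consists of the sentences true in all models of (DL), so the equivalence
    -- passes to its models in the form of universal closures.
    obtain ⟨θ₁, hθ₁⟩ := exists_closure (.imp φ ψ)
    obtain ⟨θ₂, hθ₂⟩ := exists_closure (.imp ψ φ)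
    refine ⟨ψ, hψ, fun M hM x w => ⟨(hθ₁ M).1 (hM θ₁ ?_) x w, (hθ₂ M).1 (hM θ₂ ?_) x w⟩⟩
    · exact fun N hN hdl => (hθ₁ N).2 fun x w => (h N hN hdl x w).1
    · exact fun N hN hdl => (hθ₂ N).2 fun x w => (h N hN hdl x w).2
  · obtain ⟨ψ, hψ, h⟩ := exists_fieldQuantifierFree_of_satisfiesDL hT φ
    obtain ⟨Φ, ⟨m, e, θ, hθ⟩, hψΦ⟩ := hψ.exists_definable (T := T)
    -- Without field variables there are no jet variables, so `θ` is an `L`-sentence, whose truth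
    -- value is that in `K₀`.
    obtain rfl : m = 0 := by
      rcases m with _ | m
      · rfl
      · exact (e 0).1.elim0
    obtain ⟨K₀, -, -, hK₀⟩ := hT.topological.satisfies_iff
    have key : ∀ M : Str L Unit, IsDifferentialModel T M → SatisfiesDL M χ →
        (M.Satisfies φ ↔ K₀.Satisfies θ) := by
      intro M hM hdl
      refine (h M hM hdl _ _).trans ((hψΦ M hM _ _).trans ((hθ M.reduct hM.1 _ _).trans
        (Iff.trans ?_ (hK₀ M.reduct hM.1 θ))))
      exact Eq.to_iff (congrArg (fun x => θ.Realize M.reduct x _) (Subsingleton.elim _ _))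
    by_cases h0 : K₀.Satisfies θ
    · exact Or.inl fun M hM => hM φ fun N hN hdl => (key N hN hdl).2 h0
    · exact Or.inr fun M hM hφ => hM (.imp φ .falsum)
        (fun N hN hdl hφ => h0 ((key N hN hdl).1 hφ)) hφ
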